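/- Fix $\tau_0\in\mathbf C$ with $\operatorname{Im}\tau_0>0$, put $q_0^t=e^{-2\pi i\tau_0 t}$ for $t\in\mathbf R$ (so $|q_0|>1$), and write $\mathbf S$ for the Riemann sphere. Let $\tilde B\in M_n(\mathbf C(z))$ have no pole at $0$ or $\infty$, let $\tilde z_1,\dots,\tilde z_r\in\mathbf C^*$ be its poles, and suppose that the system $$z\,\frac{d\tilde X}{dz}=\tilde B\,\tilde X\qquad(2)$$ is non-resonant at $0$ and $\infty$: two distinct eigenvalues of $\tilde B(0)$ (resp. of $\tilde B(\infty)$) never differ by an integer. Put $\tilde z_0=1$. Suppose that the $r+1$ spirals $\tilde z_iq_0^{\mathbf R}$ ($0\le i\le r$) are pairwise distinct, and that the $\tilde z_i$ are numbered so that a small circle around $0$, run through in the positive sense, meets the spirals of $\tilde z_0,\tilde z_1,\dots,\tilde z_r$ in this order. Let $\tilde\Omega'=\mathbf C^*\setminus\bigcup_{i=0}^r\tilde z_iq_0^{\mathbf R}$, and let $\tilde U_j$ ($0\le j\le r$) be the connected component of $\tilde\Omega'$ that such a circle enters when it leaves $\tilde z_jq_0^{\mathbf R}$ (so it lies between the spirals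 of $\tilde z_j$ and $\tilde z_{j+1}$, where $\tilde z_{r+1}=\tilde z_0$). Canonical solutions. Let $Q_0,Q_\infty\in GL_n(\mathbf C)$. Put $J=Q_0^{-1}\tilde BQ_0$ and $J_0=J(0)$. There is a holomorphic matrix function $Y$ on $\mathbf C\setminus\bigcup_{i=1}^r\tilde z_iq_0^{[0,\infty)}$ with $zY'=JY-YJ_0$ and $Y(0)=I_n$. Put $$\tilde X^{(0)}(z)=Q_0\,Y(z)\,(-z)^{J_0},\qquad(-z)^{J_0}=e^{J_0\log(-z)},$$ where $\log(-z)$ is the determination on $\mathbf C^*\setminus q_0^{\mathbf R}$ that vanishes at $z=-1$. Let $\tilde X^{(\infty)}$ be obtained in the same way, with $Q_\infty$, in the coordinate $w=1/z$, from the system $w\,d\tilde Y/dw=-\tilde B(1/w)\tilde Y$, on the complement of the half-spirals $\tilde z_i^{-1}q_0^{[0,\infty)}$ of the $w$-plane. Then there are unique matrices $\tilde P_0,\dots,\tilde P_r\in GL_n(\mathbf C)$ such that, for $0\le j\le r$, $$\tilde X^{(0)}(z)=\tilde X^{(\infty)}(z)\,\tilde P_j\qquad(z\in\tilde U_j);$$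 that is, the connection matrix $\tilde P=(\tilde X^{(\infty)})^{-1}\tilde X^{(0)}$ is constant on $\tilde U_j$, with value $\tilde P_j$. For $1\le j\le r$, the monodromy matrix of (2) around $\tilde z_j$ in the basis $\tilde X^{(0)}$ is $\tilde P_j^{-1}\tilde P_{j-1}$: for every sufficiently small $\rho>0$, the analytic continuation of $\tilde X^{(0)}$ along any loop of winding number $1$ around $\tilde z_j$ in the punctured disc $0<|z-\tilde z_j|<\rho$, based at a point of $\tilde U_{j-1}$, exists and transforms $\tilde X^{(0)}$ into $\tilde X^{(0)}\tilde P_j^{-1}\tilde P_{j-1}$. -/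

import Mathlib

open Filter Topology

namespace QMonodromy

noncomputable section

/-! Spirals and cuts. The base of the spirals is `q₀ = exp (-2 π i τ₀)` with `Im τ₀ > 0`. -/

/-- `q₀ ^ t = exp (-2 π i τ₀ t)` for real `t`. -/
def qpow (τ₀ : ℂ) (t : ℝ) : ℂ :=
  Complex.exp (-(2 * Real.pi * Complex.I * τ₀ * t))

/-- The logarithmic spiral `c q₀^ℝ`, without its two end points `0` and `∞`. -/
def spiral (τ₀ c : ℂ) : Set ℂ :=
  {w | ∃ t : ℝ, w = c * qpow τ₀ t}

/-- The complement in `ℂ` of the outgoing half-spirals `c i * q₀ ^ t`, `t ≥ 0`. -/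
def cutPlane {r : ℕ} (τ₀ : ℂ) (c : Fin r → ℂ) : Set ℂ :=
  {w | ∀ i, ∀ t : ℝ, 0 ≤ t → w ≠ c i * qpow τ₀ t}

/-- The family `1, z 0, …, z (r - 1)`: the auxiliary point `1` is put in front. -/
def withOne {r : ℕ} (z : Fin r → ℂ) : Fin (r + 1) → ℂ :=
  Fin.cons 1 z

/-- The Riemann sphere without the full compact spirals through the points `c i` (the points
`0` and `∞` are the end points of these spirals, and so are removed). -/
def slicedSphere {m : ℕ} (τ₀ : ℂ) (c : Fin m → ℂ) : Set ℂ :=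
  {w | w ≠ 0 ∧ ∀ i, w ∉ spiral τ₀ (c i)}

/-- A small circle around `0`, run through once in the positive sense from its point on the
spiral of `c 0`, meets the spirals of `c 0, c 1, …, c m` in this order. -/
def MetInOrder {m : ℕ} (τ₀ : ℂ) (c : Fin (m + 1) → ℂ) : Prop :=
  ∀ᶠ ρ : ℝ in 𝓝[>] 0, ∃ φ : Fin (m + 1) → ℝ,
    StrictMono φ ∧ φ (Fin.last m) < φ 0 + 2 * Real.pi ∧
      ∀ k, (ρ : ℂ) * Complex.exp (φ k * Complex.I) ∈ spiral τ₀ (c k)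

/-- The connected component of `slicedSphere τ₀ c` which a circle around `0`, run through in the
positive sense, enters when it leaves the spiral of `c j`. -/
def slice {m : ℕ} (τ₀ : ℂ) (c : Fin m → ℂ) (j : Fin m) : Set ℂ :=
  {w | ∃ p ∈ spiral τ₀ (c j), ∀ᶠ s : ℝ in 𝓝[>] 0,
    p * Complex.exp (s * Complex.I) ∈ connectedComponentIn (slicedSphere τ₀ c) w}

/-- The determination of `log (-z)` on the complement of `q₀^ℝ ∪ {0}` which vanishes at `-1`:
with `s` the real number for which `z * q₀ ^ s` has modulus one, it is
`Log (-(z * q₀ ^ s)) - log (q₀ ^ s)`, where `log (q₀ ^ s) = -2 π i τ₀ s`. -/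
def logNeg (τ₀ z : ℂ) : ℂ :=
  let s : ℝ := -Real.log ‖z‖ / (2 * Real.pi * τ₀.im)
  Complex.log (-(z * qpow τ₀ s)) + 2 * Real.pi * Complex.I * τ₀ * s

theorem exp_logNeg (τ₀ : ℂ) {z : ℂ} (hz : z ≠ 0) : Complex.exp (logNeg τ₀ z) = -z := by
  have h : ∀ s : ℝ, Complex.exp (Complex.log (-(z * qpow τ₀ s)) +
      2 * Real.pi * Complex.I * τ₀ * s) = -z := by
    intro s
    have h0 : -(z * qpow τ₀ s) ≠ 0 :=
      neg_ne_zero.mpr (mul_ne_zero hz (Complex.exp_ne_zero _))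
    rw [Complex.exp_add, Complex.exp_log h0, qpow, neg_mul, mul_assoc, ← Complex.exp_add]
    simp
  exact h _

theorem logNeg_neg_one (τ₀ : ℂ) : logNeg τ₀ (-1) = 0 := by
  simp [logNeg, qpow]

/-! The differential system `z X' = B X` with rational coefficients. -/

/-- The set of poles in `ℂ` of a matrix of rational functions. -/
def poles {n : ℕ} (B : Matrix (Fin n) (Fin n) (RatFunc ℂ)) : Set ℂ :=
  {a | ∃ i k, (B i k).denom.IsRoot a}

/-- The system `z X' = B X` is Fuchsian at `0` and at `∞`: `B` has no pole there. -/
def FuchsianAtZeroInfty {n : ℕ} (B : Matrix (Fin n) (Fin n) (RatFunc ℂ)) : Prop :=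
  (0 : ℂ) ∉ poles B ∧ ∀ i k, (B i k).num.natDegree ≤ (B i k).denom.natDegree

/-- The value of `B` at a point that is not a pole. -/
def valueAt {n : ℕ} (B : Matrix (Fin n) (Fin n) (RatFunc ℂ)) (z : ℂ) :
    Matrix (Fin n) (Fin n) ℂ :=
  Matrix.of fun i k => (B i k).eval (RingHom.id ℂ) z

/-- The value of `B` at `∞`, if `B` has no pole there (denominators are monic). -/
def valueAtInfty {n : ℕ} (B : Matrix (Fin n) (Fin n) (RatFunc ℂ)) :
    Matrix (Fin n) (Fin n) ℂ :=
  Matrix.of fun i k => (B i k).num.coeff (B i k).denom.natDegree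

/-- The matrix `D (w) = -B (1 / w)` of the same system in the coordinate `w = 1 / z`. -/
def valueInv {n : ℕ} (B : Matrix (Fin n) (Fin n) (RatFunc ℂ)) (w : ℂ) :
    Matrix (Fin n) (Fin n) ℂ :=
  if w = 0 then -valueAtInfty B else -valueAt B w⁻¹

/-- Distinct eigenvalues never differ by an integer. -/
def NonResonant {n : ℕ} (M : Matrix (Fin n) (Fin n) ℂ) : Prop :=
  ∀ a ∈ spectrum ℂ M, ∀ b ∈ spectrum ℂ M, ∀ m : ℤ, a - b = m → a = b

/-- `Y` is holomorphic on `S` and solves `z Y' = b Y - Y b(0)`, `Y(0) = 1` there. -/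
structure IsFrobeniusFactor {n : ℕ} (S : Set ℂ) (b : ℂ → Matrix (Fin n) (Fin n) ℂ)
    (Y : ℂ → Matrix (Fin n) (Fin n) ℂ) : Prop where
  differentiableOn : ∀ i k, DifferentiableOn ℂ (fun z => Y z i k) S
  equation : ∀ z ∈ S, ∀ i k, z * deriv (fun w => Y w i k) z = (b z * Y z - Y z * b 0) i k
  initial : Y 0 = 1

/-- `Q⁻¹ b Q`. -/
def conj {n : ℕ} (Q : GL (Fin n) ℂ) (b : ℂ → Matrix (Fin n) (Fin n) ℂ) (z : ℂ) :
    Matrix (Fin n) (Fin n) ℂ :=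
  (Q⁻¹).val * b z * Q.val

/-- `Q Y(z) (-z)^J` with `J = Q⁻¹ b(0) Q` and `(-z)^J = exp (J log (-z))`. If `Y` is the Frobenius
factor of `Q⁻¹ b Q`, it is the canonical solution of `z X' = b X` at `0` that belongs to `Q`:
for `Q = 1` it is `F (-z)^(b(0))`, and if `J` is in Jordan form, then `(-z)^J` is the usual block
matrix of powers and logarithms. -/
def canonicalSolution {n : ℕ} (τ₀ : ℂ) (b : ℂ → Matrix (Fin n) (Fin n) ℂ) (Q : GL (Fin n) ℂ)
    (Y : ℂ → Matrix (Fin n) (Fin n) ℂ) (z : ℂ) : Matrix (Fin n) (Fin n) ℂ :=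
  Q.val * Y z * NormedSpace.exp (logNeg τ₀ z • conj Q b 0)

/-! Analytic continuation and monodromy. -/

/-- The germ of `f` at `a` has an analytic continuation along the path `γ` from `a` to `b`, and it
ends in the germ of `g` at `b`. -/
def ContinuesTo {n : ℕ} {a b : ℂ} (γ : Path a b) (f g : ℂ → Matrix (Fin n) (Fin n) ℂ) : Prop :=
  ∃ Φ : unitInterval → ℂ → Matrix (Fin n) (Fin n) ℂ,
    (∀ t, ∀ i k, AnalyticAt ℂ (fun z => Φ t z i k) (γ t)) ∧
    (∀ t, ∀ᶠ s in 𝓝 t, Φ s =ᶠ[𝓝 (γ s)] Φ t) ∧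
    Φ 0 =ᶠ[𝓝 a] f ∧ Φ 1 =ᶠ[𝓝 b] g

/-- `γ` is a closed path in the punctured disc of radius `ρ` around `c`, and its winding number
around `c` is `1`. -/
def IsPositiveLoop (c : ℂ) (ρ : ℝ) {a : ℂ} (γ : Path a a) : Prop :=
  ∃ l : C(unitInterval, ℂ), (∀ t, γ t = c + Complex.exp (l t)) ∧ (∀ t, ‖γ t - c‖ < ρ) ∧
    l 1 = l 0 + 2 * Real.pi * Complex.I

/-- `M` is the monodromy matrix around `c` in the basis `X`, for base points in `U`: analytic
continuation along any small positive loop around `c` based at a point of `U` transforms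
`X` into `X M`. -/
def IsMonodromyMatrix {n : ℕ} (X : ℂ → Matrix (Fin n) (Fin n) ℂ) (U : Set ℂ) (c : ℂ)
    (M : Matrix (Fin n) (Fin n) ℂ) : Prop :=
  ∀ᶠ ρ : ℝ in 𝓝[>] 0, ∀ a ∈ U, ∀ γ : Path a a, IsPositiveLoop c ρ γ →
    ContinuesTo γ X (fun z => X z * M)

end

end QMonodromy

/-! In the variable u = log z the system becomes X' = B(e^u) X, and the spirals become parallel
lines of direction log q₀, along which the slanted angle `ang` is constant. With logarithms of angle
in (0, 2π), the slices become parallel strips. These are convex, and on a convex set a solution is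
determined by its value at one point; hence two solutions, one of them invertible, differ by a
constant right factor (`matrixODE_unique`). This gives the matrices P_j.

The Frobenius factor solves a linear equation on the space of matrices, z Y' = T(z) Y with T(z) Y =
b(z) Y - Y b(0). Non-resonance makes k - T(0) invertible for k ≥ 1 (`NonResonant.sylvester`), so a
formal power series solution exists, and a geometric majorant makes it converge near 0
(`frobenius_exists`). Since the cuts point outward, every point of the cut plane is joined to a
neighbourhood of 0 by a half-line u - t log q₀ in the logarithmic plane. The solution is continued
along these half-lines (`linearODE_extend`), and uniqueness makes it 2πi-periodic, hence a function
of z.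

For the monodromy, write x = z_j q₀^w near z_j. The spiral of z_j is the real axis of w; X₀ is
holomorphic off w ≥ 0 and X_∞ off w ≤ 0. Start in U_{j-1}, where Im w < 0 and X₀ = X_∞ P_{j-1}.
Crossing w > 0, where X_∞ is regular, gives X_∞ P_{j-1} = X₀ P_j⁻¹ P_{j-1} on U_j; crossing w < 0,
where X₀ is regular, changes nothing more. `exists_log_continuation` realises this by one solution
on a half-plane of the variable log w, and `continuesTo_of_log` transports it to arbitrary loops. -/

namespace QMonodromy

noncomputable section

/-! ### Linear differential equations on convex domains -/

section LinearODE

variable {E : Type*} [NormedAddCommGroup E] [NormedSpace ℂ E]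

/-- Two solutions of a linear differential equation on a convex open set which agree at one point
agree everywhere. -/
theorem linearODE_unique {s : Set ℂ} (hs : Convex ℝ s) {A : ℂ → E →L[ℂ] E}
    (hA : ContinuousOn A s) {F G : ℂ → E} (hF : ∀ u ∈ s, HasDerivAt F (A u (F u)) u)
    (hG : ∀ u ∈ s, HasDerivAt G (A u (G u)) u) {u₀ : ℂ} (hu₀ : u₀ ∈ s) (h₀ : F u₀ = G u₀)
    {u : ℂ} (hu : u ∈ s) : F u = G u := by
  let p : ℝ → ℂ := fun t => u₀ + (t : ℂ) * (u - u₀)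
  have hp : ∀ t ∈ Set.Icc (0 : ℝ) 1, p t ∈ s := fun t ht => by
    have := hs.add_smul_sub_mem hu₀ hu ht
    simpa [p] using this
  have hpd : ∀ t : ℝ, HasDerivAt p (u - u₀) t := fun t => by
    simpa [p] using ((Complex.ofRealCLM.hasDerivAt (x := t)).mul_const (u - u₀)).const_add u₀
  have hpc : Continuous p := by fun_prop
  obtain ⟨K, hK⟩ := isCompact_Icc.exists_bound_of_continuousOn
    (hA.comp hpc.continuousOn hp)
  have hd : ∀ t ∈ Set.Icc (0 : ℝ) 1, HasDerivAt (fun t => F (p t) - G (p t))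
      ((u - u₀) • A (p t) (F (p t) - G (p t))) t := fun t ht => by
    have h := ((hF _ (hp t ht)).scomp t (hpd t)).sub ((hG _ (hp t ht)).scomp t (hpd t))
    rw [map_sub, smul_sub]
    exact h
  -- Grönwall's inequality on the segment from `u₀` to `u`, applied to the difference of the two
  -- solutions.
  have key := eq_zero_of_abs_deriv_le_mul_abs_self_of_eq_zero_right
    (f := fun t : ℝ => F (p t) - G (p t)) (K := ‖u - u₀‖ * K) (a := 0) (b := 1)
    (fun t ht => (hd t ht).continuousAt.continuousWithinAt)
    (fun t ht => (hd t ⟨ht.1, ht.2.le⟩).hasDerivWithinAt)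
    (by simp [p, h₀])
    (fun t ht => by
      rw [norm_smul, mul_assoc]
      gcongr
      exact (A (p t)).le_of_opNorm_le (hK t ⟨ht.1, ht.2.le⟩) _)
    1 ⟨zero_le_one, le_rfl⟩
  simpa [p, sub_eq_zero] using key

/-- The successive terms of the Picard series of `F' = A F`. -/
theorem exists_picard_terms [CompleteSpace E] {s : Set ℂ} (hs : Convex ℝ s) (hso : IsOpen s) {A : ℂ → E →L[ℂ] E}
    (hA : DifferentiableOn ℂ A s) {u₀ : ℂ} (x₀ : E) :
    ∃ f : ℕ → ℂ → E, f 0 = (fun _ => x₀) ∧ (∀ k, f (k + 1) u₀ = 0) ∧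
      ∀ k, ∀ u ∈ s, HasDerivAt (f (k + 1)) (A u (f k u)) u := by
  have step : ∀ g : {g : ℂ → E // DifferentiableOn ℂ g s}, ∃ h : {g : ℂ → E // DifferentiableOn ℂ g s},
      h.1 u₀ = 0 ∧ ∀ u ∈ s, HasDerivAt h.1 (A u (g.1 u)) u := by
    intro g
    obtain ⟨h, hh⟩ := hs.exists_forall_hasDerivWithinAt (hA.clm_apply g.2)
    have hd : ∀ u ∈ s, HasDerivAt (fun u => h u - h u₀) (A u (g.1 u)) u := fun u hu =>
      ((hh u hu).hasDerivAt (hso.mem_nhds hu)).sub_const _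
    exact ⟨⟨fun u => h u - h u₀, fun u hu => (hd u hu).differentiableAt.differentiableWithinAt⟩,
      sub_self _, hd⟩
  choose S hS₀ hS using step
  let f : ℕ → {g : ℂ → E // DifferentiableOn ℂ g s} := fun k =>
    Nat.rec ⟨fun _ => x₀, differentiableOn_const _⟩ (fun _ g => S g) k
  exact ⟨fun k => (f k).1, rfl, fun k => hS₀ (f k), fun k => hS (f k)⟩

/-- Integrating along the segment from `u₀` turns the bound for one term into the bound for the
next; the repeated integration of powers of `t` produces the factorial. -/
theorem picard_terms_bound {K : Set ℂ} {u₀ : ℂ} (hK : StarConvex ℝ u₀ K)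
    {A : ℂ → E →L[ℂ] E} {M C : ℝ} (hM : ∀ u ∈ K, ‖A u‖ ≤ M) (hM₀ : 0 ≤ M) {f : ℕ → ℂ → E}
    (h0 : ∀ u ∈ K, ‖f 0 u‖ ≤ C) (hu₀ : ∀ k, f (k + 1) u₀ = 0)
    (hf : ∀ k, ∀ u ∈ K, HasDerivAt (f (k + 1)) (A u (f k u)) u) (k : ℕ) :
    ∀ u ∈ K, ‖f k u‖ ≤ C * ((M * ‖u - u₀‖) ^ k / k.factorial) := by
  induction k with
  | zero => simpa using h0
  | succ k ih =>
    intro u hu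
    let p : ℝ → ℂ := fun t => u₀ + (t : ℂ) * (u - u₀)
    have hp : ∀ t ∈ Set.Icc (0 : ℝ) 1, p t ∈ K := fun t ht => by
      simpa [p] using hK.add_smul_sub_mem hu ht.1 ht.2
    have hpd : ∀ t : ℝ, HasDerivAt p (u - u₀) t := fun t => by
      simpa [p] using ((Complex.ofRealCLM.hasDerivAt (x := t)).mul_const (u - u₀)).const_add u₀
    have hd : ∀ t ∈ Set.Icc (0 : ℝ) 1, HasDerivAt (fun t => f (k + 1) (p t))
        ((u - u₀) • A (p t) (f k (p t))) t := fun t ht => (hf k _ (hp t ht)).scomp t (hpd t)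
    have hB : ∀ t : ℝ, HasDerivAt
        (fun t : ℝ => C * ((M * (t * ‖u - u₀‖)) ^ (k + 1) / (k + 1).factorial))
        (‖u - u₀‖ * (M * (C * ((M * (t * ‖u - u₀‖)) ^ k / k.factorial)))) t := fun t => by
      have h := (((((hasDerivAt_id t).mul_const ‖u - u₀‖).const_mul M).pow (k + 1)).div_const
        ((k + 1).factorial : ℝ)).const_mul C
      refine h.congr_deriv ?_
      have : (k.factorial : ℝ) ≠ 0 := by positivity
      have : ((k : ℝ) + 1) ≠ 0 := by positivity
      simp [Nat.factorial_succ]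
      field_simp
    have key := image_norm_le_of_norm_deriv_right_le_deriv_boundary (a := 0) (b := 1)
      (f := fun t : ℝ => f (k + 1) (p t))
      (fun t ht => (hd t ht).continuousAt.continuousWithinAt)
      (fun t ht => (hd t ⟨ht.1, ht.2.le⟩).hasDerivWithinAt)
      (by simp [p, hu₀]) hB
      (fun t ht => by
        rw [norm_smul]
        have h1 := ih _ (hp t ⟨ht.1, ht.2.le⟩)
        have h2 : ‖p t - u₀‖ = t * ‖u - u₀‖ := by simp [p, abs_of_nonneg ht.1]
        rw [h2] at h1
        gcongr
        exact ((A (p t)).le_of_opNorm_le (hM _ (hp t ⟨ht.1, ht.2.le⟩)) _).trans (by gcongr))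
      (Set.right_mem_Icc.2 zero_le_one)
    simpa [p] using key

/-- A homogeneous linear differential equation with holomorphic coefficients on a convex open set
has a solution there, with any prescribed value at a given point. -/
theorem linearODE_exists [CompleteSpace E] {s : Set ℂ} (hs : Convex ℝ s) (hso : IsOpen s) {A : ℂ → E →L[ℂ] E}
    (hA : DifferentiableOn ℂ A s) {u₀ : ℂ} (hu₀ : u₀ ∈ s) (x₀ : E) :
    ∃ F : ℂ → E, F u₀ = x₀ ∧ ∀ u ∈ s, HasDerivAt F (A u (F u)) u := by
  obtain ⟨f, hf0, hfu, hf⟩ := exists_picard_terms hs hso hA (u₀ := u₀) x₀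
  refine ⟨fun u => ∑' k, f k u, ?_, fun u₁ hu₁ => ?_⟩
  · refine (tsum_eq_single 0 (fun k hk => ?_)).trans ?_
    rotate_left
    · simp [hf0]
    · obtain ⟨k, rfl⟩ := Nat.exists_eq_succ_of_ne_zero hk
      exact hfu k
  obtain ⟨δ, hδ, hball⟩ := Metric.nhds_basis_closedBall.mem_iff.1 (hso.mem_nhds hu₁)
  -- The cone over a closed disc around `u₁` with apex `u₀`: compact, so that `A` is bounded on it,
  -- and star-shaped, so that the bounds on the Picard terms apply.
  let K : Set ℂ := (fun q : ℝ × ℂ => u₀ + (q.1 : ℂ) * (q.2 - u₀)) ''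
    (Set.Icc 0 1 ×ˢ Metric.closedBall u₁ δ)
  have hKc : IsCompact K := (isCompact_Icc.prod (isCompact_closedBall _ _)).image (by fun_prop)
  have hKs : K ⊆ s := by
    rintro _ ⟨⟨t, u⟩, ⟨ht, hu⟩, rfl⟩
    simpa using hs.add_smul_sub_mem hu₀ (hball hu) ht
  have hKstar : StarConvex ℝ u₀ K := by
    rw [starConvex_iff_forall_pos (by
      exact ⟨(0, u₁), ⟨by simp, Metric.mem_closedBall_self hδ.le⟩, by simp⟩)]
    rintro _ ⟨⟨t, u⟩, ⟨ht, hu⟩, rfl⟩ a b ha hb hab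
    refine ⟨(b * t, u), ⟨⟨by nlinarith [ht.1], by nlinarith [ht.1, ht.2]⟩, hu⟩, ?_⟩
    have : (a : ℂ) = 1 - b := by rw [← Complex.ofReal_one, ← Complex.ofReal_sub]; congr 1; linarith
    simp [this]
    ring
  have hbK : Metric.ball u₁ δ ⊆ K := fun u hu =>
    ⟨(1, u), ⟨by simp, Metric.ball_subset_closedBall hu⟩, by simp⟩
  obtain ⟨M, hM⟩ := hKc.exists_bound_of_continuousOn (hA.continuousOn.mono hKs)
  have hM₀ : 0 ≤ M := (norm_nonneg _).trans (hM u₁ (hbK (Metric.mem_ball_self hδ)))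
  have hbd := picard_terms_bound hKstar hM hM₀ (C := ‖x₀‖) (by simp [hf0]) hfu
    (fun k u hu => hf k u (hKs hu))
  obtain ⟨D, hD⟩ := hKc.exists_bound_of_continuousOn (f := fun u => u - u₀) (by fun_prop)
  have hbd' : ∀ k, ∀ u ∈ K, ‖f k u‖ ≤ ‖x₀‖ * ((M * D) ^ k / k.factorial) := fun k u hu =>
    (hbd k u hu).trans (by have := hD u hu; gcongr)
  have hsum : Summable fun k : ℕ => ‖x₀‖ * ((M * D) ^ k / k.factorial) :=
    (Real.summable_pow_div_factorial _).mul_left _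
  -- The derivatives of the Picard terms: zero for the constant initial term, then shifted by one
  -- index.
  let g : ℕ → ℂ → E := fun k u => Nat.casesOn k 0 fun k => A u (f k u)
  have hg : ∀ k, ∀ u ∈ Metric.ball u₁ δ, HasDerivAt (f k) (g k u) u := by
    rintro (_ | k) u hu
    · simpa [hf0, g] using hasDerivAt_const u x₀
    · exact hf k u (hKs (hbK hu))
  have hgb : ∀ k, ∀ u ∈ Metric.ball u₁ δ, ‖g k u‖ ≤
      Nat.casesOn k 0 fun k => M * (‖x₀‖ * ((M * D) ^ k / k.factorial)) := by
    rintro (_ | k) u hu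
    · simp [g]
    · exact ((A u).le_of_opNorm_le (hM u (hbK hu)) _).trans
        (by have := hbd' k u (hbK hu); dsimp only; gcongr)
  have hfs : ∀ u ∈ K, Summable fun k => f k u := fun u hu =>
    Summable.of_norm_bounded hsum fun k => hbd' k u hu
  have hu₁K : u₁ ∈ K := hbK (Metric.mem_ball_self hδ)
  have key := hasDerivAt_tsum_of_isPreconnected
    (u := fun k => Nat.casesOn k 0 fun k => M * (‖x₀‖ * ((M * D) ^ k / k.factorial)))
    ((summable_nat_add_iff 1).1 (hsum.mul_left M)) Metric.isOpen_ball
    (convex_ball u₁ δ).isPreconnected hg hgb (Metric.mem_ball_self hδ) (hfs u₁ hu₁K)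
    (Metric.mem_ball_self hδ)
  refine key.congr_deriv ?_
  have hgs : Summable fun k => g k u₁ :=
    (summable_nat_add_iff 1).1 ((A u₁).summable (hfs u₁ hu₁K))
  rw [hgs.tsum_eq_zero_add, (A u₁).map_tsum (hfs u₁ hu₁K)]
  exact zero_add _

end LinearODE

/-! ### Power series solutions at a Fuchsian singularity -/

section Frobenius

variable {E : Type*} [NormedAddCommGroup E] [NormedSpace ℂ E]

/-- The coefficients of the formal solution of `z Y' = T Y`, where `T = ∑ a k z ^ k` and `R k` is
the inverse of `k - a 0`. -/
def frobeniusCoeff (a : ℕ → E →L[ℂ] E) (R : ℕ → E → E) (y₀ : E) : ℕ → E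
  | 0 => y₀
  | k + 1 => R (k + 1) (∑ i : Fin (k + 1), a (k + 1 - i) (frobeniusCoeff a R y₀ i))

/-- Passing from `k` to `k + 1` multiplies the old terms by `ρ` and adds one term with factor `K *
ρ`; together they give the ratio `ρ * (1 + K)`. -/
theorem geometric_majorant {K ρ : ℝ} (hρ : 0 ≤ ρ) (k : ℕ) :
    K * ∑ i ∈ Finset.range k, ρ ^ (k - i) * (ρ * (1 + K)) ^ i ≤ (ρ * (1 + K)) ^ k := by
  induction k with
  | zero => simp
  | succ k ih =>
    have h : ∑ i ∈ Finset.range k, ρ ^ (k + 1 - i) * (ρ * (1 + K)) ^ i =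
        ρ * ∑ i ∈ Finset.range k, ρ ^ (k - i) * (ρ * (1 + K)) ^ i := by
      rw [Finset.mul_sum]
      refine Finset.sum_congr rfl fun i hi => ?_
      rw [Nat.succ_sub (Finset.mem_range.1 hi).le, pow_succ]
      ring
    rw [Finset.sum_range_succ, h, Nat.add_sub_cancel_left, pow_one, pow_succ]
    nlinarith [mul_le_mul_of_nonneg_left ih hρ]

/-- The recursion loses a factor `C` from `R` and a factor `M` from the coefficients, so
`geometric_majorant` applies with `K = C * M`. -/
theorem norm_frobeniusCoeff_le {a : ℕ → E →L[ℂ] E} {R : ℕ → E → E} {y₀ : E} {M ρ C : ℝ}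
    (hρ : 0 ≤ ρ) (hC : 0 ≤ C) (ha : ∀ k, ‖a k‖ ≤ M * ρ ^ k)
    (hR : ∀ k, ∀ y, ‖R (k + 1) y‖ ≤ C * ‖y‖) (k : ℕ) :
    ‖frobeniusCoeff a R y₀ k‖ ≤ ‖y₀‖ * (ρ * (1 + C * M)) ^ k := by
  induction k using Nat.strong_induction_on with
  | _ k ih =>
    rcases k with _ | k
    · simp [frobeniusCoeff]
    rw [frobeniusCoeff]
    calc _ ≤ C * ‖∑ i : Fin (k + 1), a (k + 1 - i) (frobeniusCoeff a R y₀ i)‖ := hR _ _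
      _ ≤ C * ∑ i : Fin (k + 1), M * ρ ^ (k + 1 - i : ℕ) *
          (‖y₀‖ * (ρ * (1 + C * M)) ^ (i : ℕ)) := by
        gcongr
        refine (norm_sum_le _ _).trans (Finset.sum_le_sum fun i _ => ?_)
        exact (a _).le_of_opNorm_le_of_le (ha _) (ih i i.2)
      _ = ‖y₀‖ * (C * M * ∑ i ∈ Finset.range (k + 1),
          ρ ^ (k + 1 - i) * (ρ * (1 + C * M)) ^ i) := by
        rw [Fin.sum_univ_eq_sum_range
          (fun i => M * ρ ^ (k + 1 - i) * (‖y₀‖ * (ρ * (1 + C * M)) ^ i)), Finset.mul_sum,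
          Finset.mul_sum, Finset.mul_sum]
        exact Finset.sum_congr rfl fun i _ => by ring
      _ ≤ _ := by
        gcongr
        exact geometric_majorant hρ _

/-- This is the comparison of the coefficients of `z ^ k` in `z Y' = T Y`: the term with `a 0` is
the one absorbed in `R`, and degree zero is the condition on `y₀`. -/
theorem smul_frobeniusCoeff {a : ℕ → E →L[ℂ] E} {R : ℕ → E → E} {y₀ : E}
    (hy₀ : a 0 y₀ = 0)
    (hR : ∀ k : ℕ, ∀ y, ((k + 1 : ℕ) : ℂ) • R (k + 1) y - a 0 (R (k + 1) y) = y) (k : ℕ) :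
    ∑ p ∈ Finset.HasAntidiagonal.antidiagonal k, a p.1 (frobeniusCoeff a R y₀ p.2) =
      (k : ℂ) • frobeniusCoeff a R y₀ k := by
  rcases k with _ | k
  · simpa [frobeniusCoeff] using hy₀
  rw [Finset.Nat.sum_antidiagonal_eq_sum_range_succ_mk, ← Finset.sum_range_reflect,
    Finset.sum_range_succ]
  have h := hR k (∑ i : Fin (k + 1), a (k + 1 - i) (frobeniusCoeff a R y₀ i))
  rw [sub_eq_iff_eq_add] at h
  have hk : frobeniusCoeff a R y₀ (k + 1) =
      R (k + 1) (∑ i : Fin (k + 1), a (k + 1 - i) (frobeniusCoeff a R y₀ i)) := by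
    rw [frobeniusCoeff]
  rw [← hk] at h
  rw [h, Fin.sum_univ_eq_sum_range (fun i => a (k + 1 - i) (frobeniusCoeff a R y₀ i))]
  congr 1
  · refine Finset.sum_congr rfl fun i hi => ?_
    have := Finset.mem_range.1 hi
    congr 2
    all_goals omega
  · simp

/-- The Cauchy product of a power series of operators and a power series of vectors. -/
theorem hasSum_antidiagonal_clm_apply {a : ℕ → E →L[ℂ] E} {y : ℕ → E} [CompleteSpace E]
    (ha : Summable fun k => ‖a k‖) (hy : Summable fun k => ‖y k‖) :
    HasSum (fun k => ∑ p ∈ Finset.HasAntidiagonal.antidiagonal k, a p.1 (y p.2)) ((∑' k, a k) (∑' k, y k)) := by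
  have hs : Summable fun p : ℕ × ℕ => a p.1 (y p.2) :=
    Summable.of_norm_bounded (ha.mul_of_nonneg hy (fun _ => norm_nonneg _) fun _ => norm_nonneg _)
      fun p => (a p.1).le_opNorm _
  have h1 : HasSum (fun p : ℕ × ℕ => a p.1 (y p.2)) ((∑' k, a k) (∑' k, y k)) := by
    have h2 := hs.tsum_prod' fun i => (a i).summable hy.of_norm
    have h3 : ∀ i, ∑' j, a i (y j) = a i (∑' j, y j) := fun i =>
      ((a i).map_tsum hy.of_norm).symm
    simp only [h3] at h2
    have h4 := (ContinuousLinearMap.apply ℂ E (∑' j, y j)).map_tsum ha.of_norm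
    simp only [ContinuousLinearMap.apply_apply] at h4
    rw [h4, ← h2]
    exact hs.hasSum
  have h5 := (Finset.HasAntidiagonal.sigmaAntidiagonalEquivProd.hasSum_iff.2 h1).sigma
    fun k => hasSum_fintype _
  convert h5 using 1
  funext k
  exact (Finset.sum_coe_sort (Finset.HasAntidiagonal.antidiagonal k) _).symm

/-- The system `z Y' = T Y` has a holomorphic solution near `0` with value `y₀` in the kernel of
`T 0`, if the positive integers are uniformly in the resolvent set of `T 0`. -/
theorem frobenius_exists [CompleteSpace E] {T : ℂ → E →L[ℂ] E} (hT : AnalyticAt ℂ T 0)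
    {R : ℕ → E → E} {C : ℝ}
    (hR : ∀ k : ℕ, ∀ y, ((k + 1 : ℕ) : ℂ) • R (k + 1) y - T 0 (R (k + 1) y) = y)
    (hRC : ∀ k, ∀ y, ‖R (k + 1) y‖ ≤ C * ‖y‖) (hC : 0 ≤ C) {y₀ : E} (hy₀ : T 0 y₀ = 0) :
    ∃ r > 0, ∃ Y : ℂ → E, Y 0 = y₀ ∧
      ∀ z ∈ Metric.ball (0 : ℂ) r, ∃ Y', HasDerivAt Y Y' z ∧ z • Y' = T z (Y z) := by
  obtain ⟨p, hp⟩ := hT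
  have hp' := hasFPowerSeriesAt_iff.1 hp
  simp only [zero_add] at hp'
  obtain ⟨ε, hε, hsumT⟩ := Metric.eventually_nhds_iff_ball.1 hp'
  obtain ⟨M, ρ, hM, hρ, hpn⟩ := p.le_mul_pow_of_radius_pos hp.radius_pos
  have ha : ∀ k, ‖p.coeff k‖ ≤ M * ρ ^ k := fun k => by
    rw [← FormalMultilinearSeries.norm_apply_eq_norm_coef]
    exact hpn k
  have ha0 : p.coeff 0 = T 0 := by
    refine (hasSum_single 0 fun k hk => ?_).unique (hsumT 0 (Metric.mem_ball_self hε)) |>.symm ▸ ?_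
    · simp [hk]
    · simp
  set y := frobeniusCoeff p.coeff R y₀ with hy
  obtain ⟨S, hS⟩ : ∃ S, S = ρ * (1 + C * M) := ⟨_, rfl⟩
  have hyS : ∀ k, ‖y k‖ ≤ ‖y₀‖ * S ^ k :=
    hS ▸ norm_frobeniusCoeff_le hρ.le hC ha hRC
  have hrec := smul_frobeniusCoeff (a := p.coeff) (R := R) (by rwa [ha0]) (by rwa [ha0])
  have hS0 : 0 < S := by rw [hS]; positivity
  -- Since `ρ ≤ S`, the radius `1 / (2 * S)` makes the series of both `T` and the solution dominated
  -- by a geometric series of ratio `1 / 2`.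
  have hρS : ρ ≤ S := hS ▸ le_mul_of_one_le_right hρ.le (by nlinarith [mul_nonneg hC hM.le])
  have hhalf : ∀ z ∈ Metric.ball (0 : ℂ) (min ε (1 / (2 * S))), S * ‖z‖ ≤ 1 / 2 := fun z hz => by
    have := (mem_ball_zero_iff.1 hz).le.trans (min_le_right _ _)
    rw [le_div_iff₀ (by positivity)] at this
    linarith
  have hgeo : Summable fun k : ℕ => (1 / 2 : ℝ) ^ k := summable_geometric_of_lt_one (by norm_num)
    (by norm_num)
  have hlin : Summable fun k : ℕ => (k : ℝ) * (1 / 2 : ℝ) ^ (k - 1) := by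
    have := (summable_pow_mul_geometric_of_norm_lt_one (R := ℝ) 1 (r := 1 / 2)
      (by norm_num)).mul_left 2
    refine this.congr fun k => ?_
    rcases k with _ | k
    · simp
    · rw [Nat.add_sub_cancel, pow_succ]
      ring
  have hsy : ∀ z ∈ Metric.ball (0 : ℂ) (min ε (1 / (2 * S))),
      Summable fun k => ‖z ^ k • y k‖ := fun z hz => by
    refine (hgeo.mul_left ‖y₀‖).of_nonneg_of_le (fun _ => norm_nonneg _) fun k => ?_
    calc ‖z ^ k • y k‖ ≤ ‖z‖ ^ k * (‖y₀‖ * S ^ k) := by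
          rw [norm_smul, norm_pow]; gcongr; exact hyS k
      _ = ‖y₀‖ * (S * ‖z‖) ^ k := by rw [mul_pow]; ring
      _ ≤ _ := by gcongr; exact hhalf z hz
  have hsa : ∀ z ∈ Metric.ball (0 : ℂ) (min ε (1 / (2 * S))),
      Summable fun k => ‖z ^ k • p.coeff k‖ := fun z hz => by
    refine (hgeo.mul_left M).of_nonneg_of_le (fun _ => norm_nonneg _) fun k => ?_
    calc ‖z ^ k • p.coeff k‖ ≤ ‖z‖ ^ k * (M * S ^ k) := by
          rw [norm_smul, norm_pow]; gcongr; exact (ha k).trans (by gcongr)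
      _ = M * (S * ‖z‖) ^ k := by rw [mul_pow]; ring
      _ ≤ _ := by gcongr; exact hhalf z hz
  refine ⟨min ε (1 / (2 * S)), by positivity, fun z => ∑' k, z ^ k • y k, ?_, fun z hz =>
    ⟨∑' k : ℕ, (k * z ^ (k - 1)) • y k, ?_, ?_⟩⟩
  · refine (tsum_eq_single 0 fun k hk => by simp [hk]).trans ?_
    simp [hy, frobeniusCoeff]
  · refine hasDerivAt_tsum_of_isPreconnected
      (u := fun k : ℕ => ‖y₀‖ * S * (k * (1 / 2 : ℝ) ^ (k - 1))) (g := fun k z => z ^ k • y k)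
      (g' := fun k z => ((k : ℂ) * z ^ (k - 1)) • y k)
      (hlin.mul_left _) Metric.isOpen_ball (convex_ball _ _).isPreconnected
      (fun k w _ => (hasDerivAt_pow k w).smul_const (y k)) (fun k w hw => ?_) hz (hsy z hz).of_norm hz
    rcases k with _ | k
    · simp
    calc ‖(((k + 1 : ℕ) : ℂ) * w ^ (k + 1 - 1)) • y (k + 1)‖
        ≤ (k + 1 : ℕ) * ‖w‖ ^ k * (‖y₀‖ * S ^ (k + 1)) := by
          rw [norm_smul, norm_mul, norm_pow, Complex.norm_natCast, Nat.add_sub_cancel]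
          gcongr
          exact hyS _
      _ = ‖y₀‖ * S * ((k + 1 : ℕ) * (S * ‖w‖) ^ k) := by rw [mul_pow, pow_succ]; ring
      _ ≤ _ := by
          rw [Nat.add_sub_cancel]
          gcongr
          exact hhalf w hw
  · have hzε : z ∈ Metric.ball (0 : ℂ) ε := Metric.ball_subset_ball (min_le_left _ _) hz
    rw [← (hsumT z hzε).tsum_eq, ← (hasSum_antidiagonal_clm_apply (hsa z hz) (hsy z hz)).tsum_eq,
      ← tsum_const_smul'']
    refine tsum_congr fun k => ?_
    have : ∀ q ∈ Finset.HasAntidiagonal.antidiagonal k,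
        (z ^ q.1 • p.coeff q.1) (z ^ q.2 • y q.2) = z ^ k • p.coeff q.1 (y q.2) := fun q hq => by
      rw [← Finset.HasAntidiagonal.mem_antidiagonal.1 hq]
      simp [smul_smul, pow_add, mul_comm]
    rw [Finset.sum_congr rfl this, ← Finset.smul_sum, hrec, smul_smul, smul_smul]
    rcases k with _ | k
    · simp
    · rw [Nat.add_sub_cancel, pow_succ]
      congr 1
      ring

/-- If no positive integer is an eigenvalue of an operator of a finite-dimensional space, then the
positive integers are uniformly in its resolvent set. -/
theorem exists_uniform_resolvent [FiniteDimensional ℂ E] (a : E →L[ℂ] E)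
    (ha : ∀ k : ℕ, ∀ y, ((k + 1 : ℕ) : ℂ) • y - a y = 0 → y = 0) :
    ∃ (R : ℕ → E → E) (C : ℝ), 0 ≤ C ∧
      (∀ k : ℕ, ∀ y, ((k + 1 : ℕ) : ℂ) • R (k + 1) y - a (R (k + 1) y) = y) ∧
      ∀ k, ∀ y, ‖R (k + 1) y‖ ≤ C * ‖y‖ := by
  have h : ∀ k : ℕ, ∃ S : E →L[ℂ] E, ∀ y, ((k + 1 : ℕ) : ℂ) • S y - a (S y) = y := fun k => by
    let f : E →ₗ[ℂ] E := ((k + 1 : ℕ) : ℂ) • LinearMap.id - (a : E →ₗ[ℂ] E)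
    have hf : Function.Injective f := (injective_iff_map_eq_zero f).2 fun y hy => ha k y hy
    let e := LinearEquiv.ofInjectiveEndo f hf
    exact ⟨LinearMap.toContinuousLinearMap e.symm.toLinearMap, fun y => e.apply_symm_apply y⟩
  choose S hS using h
  obtain ⟨N, hN⟩ := exists_nat_ge ‖a‖
  refine ⟨fun k => S (k - 1), 1 + ∑ k ∈ Finset.range N, ‖S k‖, by positivity,
    fun k y => hS k y, fun k y => ?_⟩
  have hpos : 0 ≤ ∑ k ∈ Finset.range N, ‖S k‖ := by positivity
  simp only [Nat.add_sub_cancel]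
  by_cases hk : k < N
  · refine (S k).le_of_opNorm_le ?_ y
    have := Finset.single_le_sum (f := fun k => ‖S k‖) (fun _ _ => norm_nonneg _)
      (Finset.mem_range.2 hk)
    linarith
  -- For `k ≥ ‖a‖` the equation gives `(k + 1) ‖S k y‖ ≤ ‖y‖ + k ‖S k y‖`, so the inverse has norm
  -- at most one; only finitely many `k` need their own constant.
  · have h1 : ‖((k + 1 : ℕ) : ℂ) • S k y‖ ≤ ‖y‖ + ‖a (S k y)‖ := by
      conv_lhs => rw [← sub_add_cancel (((k + 1 : ℕ) : ℂ) • S k y) (a (S k y)), hS]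
      exact norm_add_le _ _
    have h2 := a.le_opNorm (S k y)
    have h3 : ‖a‖ ≤ k := hN.trans (by exact_mod_cast not_lt.1 hk)
    rw [norm_smul, Complex.norm_natCast] at h1
    push_cast at h1
    have h4 : ‖a‖ * ‖S k y‖ ≤ k * ‖S k y‖ := by gcongr
    nlinarith [norm_nonneg y, mul_nonneg hpos (norm_nonneg y)]

end Frobenius

/-! ### Continuation along parallel half-lines -/

section Continuation

variable {E : Type*} [NormedAddCommGroup E] [NormedSpace ℂ E]

/-- A half-line going to the left has a convex neighbourhood in any domain that contains it, down
to a given half-plane. -/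
theorem exists_convex_tube {D : Set ℂ} (hDo : IsOpen D) {v : ℂ} (hv : 0 < v.re)
    (hD : ∀ u ∈ D, ∀ t : ℝ, 0 ≤ t → u - t * v ∈ D) (κ : ℝ) {u : ℂ} (hu : u ∈ D) :
    ∃ H : Set ℂ, ∃ T : ℝ, 0 ≤ T ∧ Convex ℝ H ∧ IsOpen H ∧ H ⊆ D ∧
      ∀ᶠ w in 𝓝 u, (∀ t ∈ Set.Icc 0 T, w - t * v ∈ H) ∧ (w - T * v).re < κ := by
  obtain ⟨T, hT0, hT⟩ : ∃ T : ℝ, 0 ≤ T ∧ u.re - T * v.re < κ := by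
    refine ⟨|u.re - κ| / v.re + 1, by positivity, ?_⟩
    have := le_abs_self (u.re - κ)
    rw [add_mul, div_mul_cancel₀ _ hv.ne']
    linarith
  let p : ℝ → ℂ := fun t => u - t * v
  have hseg : Convex ℝ (p '' Set.Icc 0 T) := by
    rintro _ ⟨t, ht, rfl⟩ _ ⟨t', ht', rfl⟩ a b ha hb hab
    refine ⟨a * t + b * t', convex_Icc 0 T ht ht' ha hb hab, ?_⟩
    have : (a : ℂ) + b = 1 := by exact_mod_cast hab
    simp only [p, Complex.real_smul]
    push_cast
    linear_combination (-u) * this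
  have hc : IsCompact (p '' Set.Icc 0 T) := isCompact_Icc.image (by fun_prop)
  obtain ⟨δ, hδ, hsub⟩ := hc.exists_thickening_subset_open hDo (by
    rintro _ ⟨t, ht, rfl⟩
    exact hD u hu t ht.1)
  refine ⟨_, T, hT0, hseg.thickening δ, Metric.isOpen_thickening, hsub, ?_⟩
  have h1 : ∀ᶠ w in 𝓝 u, (w - T * v).re < κ :=
    (isOpen_lt (f := fun w : ℂ => (w - T * v).re) (by fun_prop) continuous_const).mem_nhds
      (by simpa using hT)
  filter_upwards [Metric.ball_mem_nhds u hδ, h1] with w hw h1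
  refine ⟨fun t ht => Metric.mem_thickening_iff.2 ⟨_, ⟨t, ht, rfl⟩, ?_⟩, h1⟩
  simpa [p] using hw

/-- The convex tube around the half-line from `u` reaches the half-plane where the solutions agree.
-/
theorem linearODE_unique_of_left {D : Set ℂ} (hDo : IsOpen D) {v : ℂ} (hv : 0 < v.re)
    (hD : ∀ u ∈ D, ∀ t : ℝ, 0 ≤ t → u - t * v ∈ D) {κ : ℝ} {A : ℂ → E →L[ℂ] E}
    (hA : ContinuousOn A D) {F G : ℂ → E} (hF : ∀ u ∈ D, HasDerivAt F (A u (F u)) u)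
    (hG : ∀ u ∈ D, HasDerivAt G (A u (G u)) u) (h₀ : ∀ u : ℂ, u.re < κ → F u = G u)
    {u : ℂ} (hu : u ∈ D) : F u = G u := by
  obtain ⟨H, T, hT, hHc, -, hHD, hH⟩ := exists_convex_tube hDo hv hD κ hu
  have h := hH.self_of_nhds
  refine linearODE_unique hHc (hA.mono hHD) (fun u hu => hF u (hHD hu))
    (fun u hu => hG u (hHD hu)) (h.1 T ⟨hT, le_rfl⟩) (h₀ _ h.2) ?_
  simpa using h.1 0 ⟨le_rfl, hT⟩

/-- Continuation of the solutions of a linear differential equation along the half-lines with a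
given direction. -/
theorem linearODE_extend [CompleteSpace E] {D : Set ℂ} (hDo : IsOpen D) {v : ℂ} (hv : 0 < v.re)
    (hD : ∀ u ∈ D, ∀ t : ℝ, 0 ≤ t → u - t * v ∈ D) {κ : ℝ} (hκ : ∀ u : ℂ, u.re < κ → u ∈ D)
    {A : ℂ → E →L[ℂ] E} (hA : DifferentiableOn ℂ A D) {F₀ : ℂ → E}
    (hF₀ : ∀ u : ℂ, u.re < κ → HasDerivAt F₀ (A u (F₀ u)) u) :
    ∃ F : ℂ → E, (∀ u : ℂ, u.re < κ → F u = F₀ u) ∧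
      ∀ u ∈ D, HasDerivAt F (A u (F u)) u := by
  have hhalf : Convex ℝ {u : ℂ | u.re < κ} := convex_halfSpace_re_lt κ
  have hex : ∀ u : D, ∃ H : Set ℂ, ∃ T : ℝ, ∃ G : ℂ → E, 0 ≤ T ∧ Convex ℝ H ∧ IsOpen H ∧ H ⊆ D ∧
      (∀ᶠ w in 𝓝 u.1, (∀ t ∈ Set.Icc 0 T, w - t * v ∈ H) ∧ (w - T * v).re < κ) ∧
      (∀ w ∈ H, HasDerivAt G (A w (G w)) w) ∧ ∀ w ∈ H, w.re < κ → G w = F₀ w := by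
    intro u
    obtain ⟨H, T, hT, hHc, hHo, hHD, hH⟩ := exists_convex_tube hDo hv hD κ u.2
    have h := hH.self_of_nhds
    obtain ⟨G, hG₀, hG⟩ := linearODE_exists hHc hHo (hA.mono hHD) (h.1 T ⟨hT, le_rfl⟩)
      (F₀ (u.1 - T * v))
    refine ⟨H, T, G, hT, hHc, hHo, hHD, hH, hG, fun w hw hwκ => ?_⟩
    exact linearODE_unique (hHc.inter hhalf) (hA.continuousOn.mono fun x hx => hHD hx.1)
      (fun x hx => hG x hx.1) (fun x hx => hF₀ x hx.2) ⟨h.1 T ⟨hT, le_rfl⟩, h.2⟩ hG₀ ⟨hw, hwκ⟩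
  choose H T G hT hHc hHo hHD hH hG hGF using hex
  have hself : ∀ u : D, u.1 ∈ H u := fun u => by
    simpa using (hH u).self_of_nhds.1 0 ⟨le_rfl, hT u⟩
  classical
  let F : ℂ → E := fun u => if hu : u ∈ D then G ⟨u, hu⟩ u else 0
  have hFD : ∀ u : D, F u = G u u := fun u => dif_pos u.2
  have hFG : ∀ u : D, F =ᶠ[𝓝 u.1] G u := fun u => by
    filter_upwards [hH u, hDo.mem_nhds u.2] with w hw hwD
    rw [hFD ⟨w, hwD⟩]
    -- With the smaller of the two lengths, `w - t * v` lies in both tubes and still, as the end of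
    -- one of the two segments, in the half-plane where both local solutions equal `F₀`.
    let t := min (T u) (T ⟨w, hwD⟩)
    have ht0 : 0 ≤ t := le_min (hT _) (hT _)
    have h1 : w - t * v ∈ H u := hw.1 t ⟨ht0, min_le_left _ _⟩
    have h2 : w - t * v ∈ H ⟨w, hwD⟩ :=
      (hH ⟨w, hwD⟩).self_of_nhds.1 t ⟨ht0, min_le_right _ _⟩
    have h3 : (w - t * v).re < κ := by
      rcases min_choice (T u) (T ⟨w, hwD⟩) with h | h
      · rw [show t = T u from h]; exact hw.2
      · rw [show t = T ⟨w, hwD⟩ from h]; exact (hH ⟨w, hwD⟩).self_of_nhds.2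
    refine linearODE_unique ((hHc ⟨w, hwD⟩).inter (hHc u))
      (hA.continuousOn.mono fun x hx => hHD u hx.2) (fun x hx => hG _ x hx.1)
      (fun x hx => hG _ x hx.2) ⟨h2, h1⟩ ?_ ⟨hself ⟨w, hwD⟩, ?_⟩
    · rw [hGF _ _ h2 h3, hGF _ _ h1 h3]
    · simpa using hw.1 0 ⟨le_rfl, hT u⟩
  refine ⟨F, fun u hu => ?_, fun u hu => ?_⟩
  · rw [hFD ⟨u, hκ u hu⟩]
    exact hGF _ _ (hself _) hu
  · have := (hG ⟨u, hu⟩ u (hself _)).congr_of_eventuallyEq (hFG ⟨u, hu⟩)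
    rwa [← hFD ⟨u, hu⟩] at this

end Continuation

/-! ### The cut plane and its logarithmic cover -/

section CutPlane

/-- The logarithm `-2 π i τ₀` of `q₀`. -/
def logq (τ₀ : ℂ) : ℂ := -(2 * Real.pi * Complex.I * τ₀)

theorem qpow_eq_exp (τ₀ : ℂ) (t : ℝ) : qpow τ₀ t = Complex.exp (t * logq τ₀) := by
  rw [qpow, logq]
  ring_nf

theorem logq_re (τ₀ : ℂ) : (logq τ₀).re = 2 * Real.pi * τ₀.im := by
  simp [logq]

theorem logq_im (τ₀ : ℂ) : (logq τ₀).im = -(2 * Real.pi * τ₀.re) := by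
  simp [logq]

theorem logq_re_pos {τ₀ : ℂ} (hτ₀ : 0 < τ₀.im) : 0 < (logq τ₀).re := by
  rw [logq_re]
  positivity

/-- The modulus increases strictly along a half-spiral, so it determines the parameter. Each
half-spiral is therefore the zero set of a continuous function on the closed set `‖c i‖ ≤ ‖w‖`. -/
theorem isOpen_cutPlane {r : ℕ} {τ₀ : ℂ} (hτ₀ : 0 < τ₀.im) {c : Fin r → ℂ} (hc : ∀ i, c i ≠ 0) :
    IsOpen (cutPlane τ₀ c) := by
  have hv := logq_re_pos hτ₀
  have key : ∀ i, IsClosed {w : ℂ | ∃ t : ℝ, 0 ≤ t ∧ w = c i * qpow τ₀ t} := by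
    intro i
    have hci : 0 < ‖c i‖ := norm_pos_iff.2 (hc i)
    let f : ℂ → ℂ := fun w =>
      w - c i * Complex.exp ((Real.log (‖w‖ / ‖c i‖) / (logq τ₀).re : ℝ) * logq τ₀)
    have hf : ContinuousOn f {w | ‖c i‖ ≤ ‖w‖} := by
      have : ContinuousOn (fun w : ℂ => Real.log (‖w‖ / ‖c i‖)) {w | ‖c i‖ ≤ ‖w‖} :=
        ContinuousOn.log (by fun_prop) fun w hw => (div_pos (hci.trans_le hw) hci).ne'
      fun_prop
    have h1 := hf.preimage_isClosed_of_isClosed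
      (isClosed_le continuous_const continuous_norm) (isClosed_singleton (x := 0))
    convert h1 using 1
    ext w
    simp only [Set.mem_ofPred_eq, Set.mem_inter_iff, Set.mem_preimage, Set.mem_singleton_iff, f,
      sub_eq_zero, qpow_eq_exp]
    constructor
    · rintro ⟨t, ht, rfl⟩
      have hn : ‖c i * Complex.exp (t * logq τ₀)‖ = ‖c i‖ * Real.exp (t * (logq τ₀).re) := by
        simp [Complex.norm_exp]
      rw [hn]
      refine ⟨le_mul_of_one_le_right hci.le (Real.one_le_exp (by positivity)), ?_⟩
      rw [mul_div_cancel_left₀ _ hci.ne', Real.log_exp, mul_div_cancel_right₀ _ hv.ne']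
    · rintro ⟨hw, h⟩
      exact ⟨_, div_nonneg (Real.log_nonneg ((one_le_div hci).2 hw)) hv.le, h⟩
  have : cutPlane τ₀ c = ⋂ i, {w : ℂ | ∃ t : ℝ, 0 ≤ t ∧ w = c i * qpow τ₀ t}ᶜ := by
    ext w
    simp [cutPlane]
  rw [this]
  exact isOpen_iInter_of_finite fun i => (key i).isOpen_compl

theorem zero_mem_cutPlane {r : ℕ} (τ₀ : ℂ) {c : Fin r → ℂ} (hc : ∀ i, c i ≠ 0) :
    0 ∈ cutPlane τ₀ c :=
  fun i _ _ => (mul_ne_zero (hc i) (Complex.exp_ne_zero _)).symm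

/-- A point that flows inward onto an outgoing half-spiral was already on it. -/
theorem exp_sub_mem_cutPlane {r : ℕ} {τ₀ : ℂ} {c : Fin r → ℂ} {u : ℂ}
    (hu : Complex.exp u ∈ cutPlane τ₀ c) {t : ℝ} (ht : 0 ≤ t) :
    Complex.exp (u - t * logq τ₀) ∈ cutPlane τ₀ c := by
  intro i s hs h
  refine hu i (s + t) (add_nonneg hs ht) ?_
  rw [qpow_eq_exp] at h ⊢
  rw [Complex.ofReal_add, add_mul, Complex.exp_add, ← mul_assoc, ← h, ← Complex.exp_add,
    sub_add_cancel]

variable {E : Type*} [NormedAddCommGroup E] [NormedSpace ℂ E] [CompleteSpace E]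

/-- The solution of a system `z Y' = T Y` given by `frobenius_exists` is holomorphic on the
complement of the half-spirals through the poles of `T`. -/
theorem frobenius_exists_cutPlane {r : ℕ} {τ₀ : ℂ} (hτ₀ : 0 < τ₀.im) {c : Fin r → ℂ}
    (hc : ∀ i, c i ≠ 0) {T : ℂ → E →L[ℂ] E} (hT : DifferentiableOn ℂ T (cutPlane τ₀ c))
    {R : ℕ → E → E} {C : ℝ}
    (hR : ∀ k : ℕ, ∀ y, ((k + 1 : ℕ) : ℂ) • R (k + 1) y - T 0 (R (k + 1) y) = y)
    (hRC : ∀ k, ∀ y, ‖R (k + 1) y‖ ≤ C * ‖y‖) (hC : 0 ≤ C) {y₀ : E} (hy₀ : T 0 y₀ = 0) :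
    ∃ Y : ℂ → E, Y 0 = y₀ ∧
      ∀ z ∈ cutPlane τ₀ c, ∃ Y', HasDerivAt Y Y' z ∧ z • Y' = T z (Y z) := by
  have hopen := isOpen_cutPlane hτ₀ hc
  have h0 := zero_mem_cutPlane τ₀ hc
  have hv := logq_re_pos hτ₀
  obtain ⟨ρ, hρ, Y₀, hY₀0, hY₀⟩ := frobenius_exists
    (hT.analyticAt (hopen.mem_nhds h0)) hR hRC hC hy₀
  obtain ⟨ρ', hρ', hball⟩ := Metric.isOpen_iff.1 hopen 0 h0
  let δ := min ρ ρ'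
  have hδ : 0 < δ := lt_min hρ hρ'
  let κ := Real.log δ
  have hκ : ∀ u : ℂ, u.re < κ ↔ ‖Complex.exp u‖ < δ := fun u => by
    rw [Complex.norm_exp, Real.lt_log_iff_exp_lt hδ]
  let D : Set ℂ := Complex.exp ⁻¹' cutPlane τ₀ c
  have hDo : IsOpen D := hopen.preimage Complex.continuous_exp
  have hD : ∀ u ∈ D, ∀ t : ℝ, 0 ≤ t → u - t * logq τ₀ ∈ D := fun u hu t ht =>
    exp_sub_mem_cutPlane hu ht
  have hκD : ∀ u : ℂ, u.re < κ → u ∈ D := fun u hu =>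
    hball (mem_ball_zero_iff.2 (((hκ u).1 hu).trans_le (min_le_right _ _)))
  have hA : DifferentiableOn ℂ (fun u => T (Complex.exp u)) D :=
    hT.comp Complex.differentiable_exp.differentiableOn fun u hu => hu
  obtain ⟨F, hF₀, hF⟩ := linearODE_extend hDo hv hD hκD hA (F₀ := fun u => Y₀ (Complex.exp u))
    fun u hu => by
      obtain ⟨Y', h1, h2⟩ := hY₀ (Complex.exp u)
        (mem_ball_zero_iff.2 (((hκ u).1 hu).trans_le (min_le_left _ _)))
      rw [← h2]
      exact h1.scomp u (Complex.hasDerivAt_exp u)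
  have hexp : ∀ u : ℂ, Complex.exp (u + 2 * Real.pi * Complex.I) = Complex.exp u := fun u => by
    simpa using Complex.exp_periodic u
  -- Both `F` and its translate continue the same function `Y₀ ∘ exp` of the left half-plane. Off
  -- `D` the values of `F` are arbitrary; the indicator makes the periodicity hold on all of `ℂ`.
  have hper : Function.Periodic (D.indicator F) (2 * Real.pi * Complex.I) := fun u => by
    have hiff : u + 2 * Real.pi * Complex.I ∈ D ↔ u ∈ D := by
      simp only [D, Set.mem_preimage, hexp]
    by_cases hu : u ∈ D
    · rw [Set.indicator_of_mem (hiff.2 hu), Set.indicator_of_mem hu]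
      refine linearODE_unique_of_left hDo hv hD (κ := κ) hA.continuousOn
        (F := fun u => F (u + 2 * Real.pi * Complex.I)) (fun w hw => ?_) hF (fun w hw => ?_) hu
      · have := HasDerivAt.comp_add_const w (2 * Real.pi * Complex.I)
          (hF (w + 2 * Real.pi * Complex.I) (by simpa only [D, Set.mem_preimage, hexp] using hw))
        rwa [hexp] at this
      · rw [hF₀ w hw, hF₀ _ (by simpa using hw), hexp]
    · rw [Set.indicator_of_notMem (hiff.not.2 hu), Set.indicator_of_notMem hu]
  let Y : ℂ → E := fun z => if z = 0 then y₀ else D.indicator F (Complex.log z)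
  have hYexp : ∀ u, Y (Complex.exp u) = D.indicator F u := fun u => by
    have h1 : Complex.exp (Complex.log (Complex.exp u)) = Complex.exp u :=
      Complex.exp_log (Complex.exp_ne_zero u)
    obtain ⟨k, hk⟩ := Complex.exp_eq_exp_iff_exists_int.1 h1
    simp only [Y, Complex.exp_ne_zero, if_false, hk]
    exact hper.int_mul k u
  refine ⟨Y, if_pos rfl, fun z hz => ?_⟩
  by_cases hz0 : z = 0
  · subst hz0
    have hev : Y =ᶠ[𝓝 0] Y₀ := by
      filter_upwards [Metric.ball_mem_nhds (0 : ℂ) hδ] with z hz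
      by_cases hz0 : z = 0
      · simp [Y, hz0, hY₀0]
      · have h1 := Complex.exp_log hz0
        have h2 : (Complex.log z).re < κ := (hκ _).2 (by rw [h1]; exact mem_ball_zero_iff.1 hz)
        rw [← h1, hYexp, Set.indicator_of_mem (hκD _ h2), hF₀ _ h2]
    obtain ⟨Y', h1, -⟩ := hY₀ 0 (Metric.mem_ball_self hρ)
    exact ⟨Y', h1.congr_of_eventuallyEq hev, by simp [Y, hy₀]⟩
  · have hu : Complex.exp (Complex.log z) = z := Complex.exp_log hz0
    have huD : Complex.log z ∈ D := by rw [Set.mem_preimage, hu]; exact hz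
    -- A branch of the logarithm that is holomorphic near `z` even when `z` lies on the cut of
    -- `Complex.log`.
    have hd : HasDerivAt (fun w => Complex.log z + Complex.log (w / z)) z⁻¹ z := by
      have := ((hasDerivAt_id z).div_const z).clog (by simp [hz0])
      simpa [hz0] using this.const_add (Complex.log z)
    have hval : Complex.log z + Complex.log (z / z) = Complex.log z := by simp [hz0]
    have hFD : D.indicator F =ᶠ[𝓝 (Complex.log z)] F := by
      filter_upwards [hDo.mem_nhds huD] with w hw using Set.indicator_of_mem hw F
    have hFd := (hF _ huD).congr_of_eventuallyEq hFD
    have hcomp := HasDerivAt.scomp_of_eq z hFd hd hval.symm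
    refine ⟨_, hcomp.congr_of_eventuallyEq ?_, ?_⟩
    · filter_upwards [isOpen_ne.mem_nhds hz0] with w hw
      have : Complex.exp (Complex.log z + Complex.log (w / z)) = w := by
        rw [Complex.exp_add, hu, Complex.exp_log (div_ne_zero hw hz0), mul_div_cancel₀ _ hz0]
      rw [← this, hYexp, this]
      rfl
    · have : Y z = F (Complex.log z) := by
        conv_lhs => rw [← hu]
        rw [hYexp, Set.indicator_of_mem huD]
      rw [smul_smul, mul_inv_cancel₀ hz0, one_smul, this, hu]

end CutPlane

/-! ### Non-resonance and the Sylvester equation -/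

section Sylvester

variable {n : ℕ}

/-- The Sylvester equation `k X = M X - X M`, for a nonzero integer `k`, has only the zero solution
if distinct eigenvalues of `M` never differ by an integer. -/
theorem NonResonant.sylvester {M : Matrix (Fin n) (Fin n) ℂ} (hM : NonResonant M) {k : ℤ}
    (hk : k ≠ 0) {X : Matrix (Fin n) (Fin n) ℂ} (hX : (k : ℂ) • X = M * X - X * M) : X = 0 := by
  rcases n.eq_zero_or_pos with rfl | hn
  · exact Subsingleton.elim _ _
  have : Nonempty (Fin n) := ⟨⟨0, hn⟩⟩
  -- The equation says `X M = N X`, hence `X p(M) = p(N) X` for every polynomial `p`. For the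
  -- characteristic polynomial of `M`, Cayley–Hamilton gives `p(N) X = 0`.
  let N := M - algebraMap ℂ _ (k : ℂ)
  have hcomm : SemiconjBy X M N := by
    rw [SemiconjBy, sub_mul, Algebra.algebraMap_eq_smul_one, smul_mul_assoc, one_mul, hX]
    abel
  have hpoly : ∀ p : Polynomial ℂ,
      X * Polynomial.aeval M p = Polynomial.aeval N p * X := by
    intro p
    induction p using Polynomial.induction_on' with
    | add p q hp hq => rw [map_add, map_add, mul_add, add_mul, hp, hq]
    | monomial j a =>
      rw [Polynomial.aeval_monomial, Polynomial.aeval_monomial, Algebra.algebraMap_eq_smul_one,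
        smul_mul_assoc, smul_mul_assoc, one_mul, one_mul, mul_smul_comm, smul_mul_assoc,
        (hcomm.pow_right j).eq]
  have h0 : Polynomial.aeval N M.charpoly * X = 0 := by
    rw [← hpoly, Matrix.aeval_self_charpoly, mul_zero]
  -- By spectral mapping, a failure would give a common eigenvalue `μ` of `N` and `M`; then `μ` and
  -- `μ + k` are both eigenvalues of `M`.
  have hunit : IsUnit (Polynomial.aeval N M.charpoly) := by
    rw [← spectrum.zero_notMem_iff ℂ, spectrum.map_polynomial_aeval_of_degree_pos]
    · rintro ⟨μ, hμ, hμ0⟩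
      have h1 : μ ∈ spectrum ℂ M := Matrix.mem_spectrum_iff_isRoot_charpoly.2 hμ0
      have h2 : μ + k ∈ spectrum ℂ M := by
        have := spectrum.add_mem_add_iff (r := μ) (s := (k : ℂ)) (a := N)
        rw [show algebraMap ℂ _ (k : ℂ) + N = M from add_sub_cancel _ _] at this
        exact this.2 hμ
      have h3 := hM _ h2 _ h1 k (by ring)
      exact hk (by exact_mod_cast add_eq_left.1 h3)
    · rw [M.charpoly_degree_eq_dim]
      simpa using hn
  exact hunit.mul_right_eq_zero.1 h0

theorem NonResonant.neg {M : Matrix (Fin n) (Fin n) ℂ} (hM : NonResonant M) :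
    NonResonant (-M) := by
  intro a ha b hb m h
  rw [← spectrum.neg_eq, Set.mem_neg] at ha hb
  have := hM _ ha _ hb (-m) (by push_cast; rw [← h]; ring)
  exact neg_injective this

theorem NonResonant.conj {b : ℂ → Matrix (Fin n) (Fin n) ℂ} (hb : NonResonant (b 0))
    (Q : GL (Fin n) ℂ) : NonResonant (conj Q b 0) := by
  unfold NonResonant QMonodromy.conj
  rw [spectrum.units_conjugate']
  exact hb

end Sylvester

/-! ### Matrix systems and the Frobenius factor -/

section MatrixSystem

open scoped Matrix.Norms.Operator

variable {n : ℕ}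

theorem hasDerivAt_matrix {F : ℂ → Matrix (Fin n) (Fin n) ℂ} {F' : Matrix (Fin n) (Fin n) ℂ}
    {z : ℂ} : HasDerivAt F F' z ↔ ∀ i k, HasDerivAt (fun w => F w i k) (F' i k) z := by
  constructor
  · intro h i k
    exact ((LinearMap.toContinuousLinearMap
      (Matrix.entryLinearMap ℂ ℂ i k)).hasFDerivAt (x := F z)).comp_hasDerivAt z h
  · intro h
    have : HasDerivAt (fun w => ∑ i, ∑ k, F w i k • Matrix.single i k (1 : ℂ))
        (∑ i, ∑ k, F' i k • Matrix.single i k (1 : ℂ)) z :=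
      HasDerivAt.fun_sum fun i _ => HasDerivAt.fun_sum fun k _ => (h i k).smul_const _
    have hM : ∀ M : Matrix (Fin n) (Fin n) ℂ,
        ∑ i, ∑ k, M i k • Matrix.single i k (1 : ℂ) = M := fun M => by
      conv_rhs => rw [Matrix.matrix_eq_sum_single M]
      simp
    simpa only [hM] using this

theorem differentiableAt_matrix {F : ℂ → Matrix (Fin n) (Fin n) ℂ} {z : ℂ} :
    DifferentiableAt ℂ F z ↔ ∀ i k, DifferentiableAt ℂ (fun w => F w i k) z := by
  refine ⟨fun h i k => (hasDerivAt_matrix.1 h.hasDerivAt i k).differentiableAt, fun h => ?_⟩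
  exact (hasDerivAt_matrix (F' := Matrix.of fun i k => deriv (fun w => F w i k) z).2
    fun i k => (h i k).hasDerivAt).differentiableAt

theorem IsFrobeniusFactor.hasDerivAt {S : Set ℂ} (hS : IsOpen S)
    {b Y : ℂ → Matrix (Fin n) (Fin n) ℂ} (hY : IsFrobeniusFactor S b Y) {z : ℂ} (hz : z ∈ S) :
    ∃ Y', HasDerivAt Y Y' z ∧ z • Y' = b z * Y z - Y z * b 0 := by
  refine ⟨Matrix.of fun i k => deriv (fun w => Y w i k) z, hasDerivAt_matrix.2 fun i k => ?_, ?_⟩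
  · exact ((hY.differentiableOn i k).differentiableAt (hS.mem_nhds hz)).hasDerivAt
  · ext i k
    exact hY.equation z hz i k

theorem DifferentiableOn.conj {S : Set ℂ} {b : ℂ → Matrix (Fin n) (Fin n) ℂ}
    (hb : DifferentiableOn ℂ b S) (Q : GL (Fin n) ℂ) : DifferentiableOn ℂ (conj Q b) S :=
  (hb.const_mul _).mul_const _

/-- A non-resonant system has a Frobenius factor. -/
theorem exists_isFrobeniusFactor {r : ℕ} {τ₀ : ℂ} (hτ₀ : 0 < τ₀.im) {c : Fin r → ℂ}
    (hc : ∀ i, c i ≠ 0) {b : ℂ → Matrix (Fin n) (Fin n) ℂ}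
    (hb : DifferentiableOn ℂ b (cutPlane τ₀ c)) (hres : NonResonant (b 0)) :
    ∃ Y, IsFrobeniusFactor (cutPlane τ₀ c) b Y := by
  let 𝔸 := Matrix (Fin n) (Fin n) ℂ
  -- The Frobenius equation is linear on the space of matrices; the initial value `1` lies in the
  -- kernel of `T 0`, and the Sylvester equation for `b 0` gives the resolvent condition.
  let T : ℂ → 𝔸 →L[ℂ] 𝔸 := fun z =>
    ContinuousLinearMap.mul ℂ 𝔸 (b z) - (ContinuousLinearMap.mul ℂ 𝔸).flip (b 0)
  have hTapp : ∀ z Y, T z Y = b z * Y - Y * b 0 := fun z Y => rfl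
  have hT : DifferentiableOn ℂ T (cutPlane τ₀ c) :=
    ((ContinuousLinearMap.mul ℂ 𝔸).differentiable.comp_differentiableOn hb).sub_const _
  obtain ⟨R, C, hC, hR, hRC⟩ := exists_uniform_resolvent (T 0) fun k Y hY => by
    refine hres.sylvester (k := (k + 1 : ℕ)) (by positivity) ?_
    rw [← hTapp]
    exact sub_eq_zero.1 hY
  obtain ⟨Y, hY0, hY⟩ := frobenius_exists_cutPlane hτ₀ hc hT hR hRC hC (y₀ := 1)
    ((hTapp 0 1).trans (by rw [mul_one, one_mul, sub_self]))
  refine ⟨Y, fun i k z hz => ?_, fun z hz i k => ?_, hY0⟩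
  · obtain ⟨Y', hd, -⟩ := hY z hz
    exact (hasDerivAt_matrix.1 hd i k).differentiableAt.differentiableWithinAt
  · obtain ⟨Y', hd, he⟩ := hY z hz
    rw [(hasDerivAt_matrix.1 hd i k).deriv]
    exact congrFun₂ (he.trans (hTapp z (Y z))) i k

/-- Two solutions of `F' = A F` on a convex set, one of them invertible at one point, differ by a
constant matrix on the right. -/
theorem matrixODE_unique {s : Set ℂ} (hs : Convex ℝ s) {A F G : ℂ → Matrix (Fin n) (Fin n) ℂ}
    (hA : ContinuousOn A s) (hF : ∀ u ∈ s, HasDerivAt F (A u * F u) u)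
    (hG : ∀ u ∈ s, HasDerivAt G (A u * G u) u) {u₀ : ℂ} (hu₀ : u₀ ∈ s)
    {P : Matrix (Fin n) (Fin n) ℂ} (h₀ : F u₀ = G u₀ * P) {u : ℂ} (hu : u ∈ s) :
    F u = G u * P := by
  refine linearODE_unique hs (A := fun u => ContinuousLinearMap.mul ℂ _ (A u))
    (G := fun u => G u * P) ((ContinuousLinearMap.mul ℂ _).continuous.comp_continuousOn hA) hF
    (fun u hu => ?_) hu₀ h₀ hu
  have := (hG u hu).mul_const P
  rwa [mul_assoc] at this

/-- A solution of `F' = A F` on a convex set which is invertible at one point is invertible. -/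
theorem matrixODE_isUnit {s : Set ℂ} (hs : Convex ℝ s) {A F : ℂ → Matrix (Fin n) (Fin n) ℂ}
    (hA : ContinuousOn A s) (hF : ∀ u ∈ s, HasDerivAt F (A u * F u) u) {u₀ : ℂ} (hu₀ : u₀ ∈ s)
    (h₀ : IsUnit (F u₀)) {u : ℂ} (hu : u ∈ s) : IsUnit (F u) := by
  have hinj : Function.Injective (LinearMap.mulLeft ℂ (F u)) := by
    rw [injective_iff_map_eq_zero]
    intro X hX
    rw [LinearMap.mulLeft_apply] at hX
    -- If `F u * X = 0`, then `F * X` is a solution that vanishes at `u`, hence also at `u₀`, where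
    -- `F` is invertible.
    have h1 := linearODE_unique hs (A := fun u => ContinuousLinearMap.mul ℂ _ (A u))
      (F := fun u => F u * X) (G := fun _ => 0)
      ((ContinuousLinearMap.mul ℂ _).continuous.comp_continuousOn hA) (fun u hu => by
        have := (hF u hu).mul_const X
        rwa [mul_assoc] at this) (fun u _ => by simpa using hasDerivAt_const u _) hu hX hu₀
    exact h₀.mul_right_eq_zero.1 h1
  obtain ⟨X, hX⟩ := LinearMap.injective_iff_surjective.1 hinj 1
  exact IsUnit.of_mul_eq_one _ hX

/-- The Frobenius factor is invertible. -/
theorem IsFrobeniusFactor.isUnit {r : ℕ} {τ₀ : ℂ} (hτ₀ : 0 < τ₀.im) {c : Fin r → ℂ}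
    (hc : ∀ i, c i ≠ 0) {b Y : ℂ → Matrix (Fin n) (Fin n) ℂ}
    (hb : DifferentiableOn ℂ b (cutPlane τ₀ c)) (hY : IsFrobeniusFactor (cutPlane τ₀ c) b Y)
    {u : ℂ} (hu : Complex.exp u ∈ cutPlane τ₀ c) : IsUnit (Y (Complex.exp u)) := by
  have hopen := isOpen_cutPlane hτ₀ hc
  let D : Set ℂ := Complex.exp ⁻¹' cutPlane τ₀ c
  -- The exponential factor absorbs the term `-Y b(0)`, so `W' = b W`. Invertibility near `0`, where
  -- `Y` is close to `1`, then propagates along a tube.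
  let W : ℂ → Matrix (Fin n) (Fin n) ℂ := fun u =>
    Y (Complex.exp u) * NormedSpace.exp (u • b 0)
  have hexpu : ∀ u : ℂ, IsUnit (NormedSpace.exp (u • b 0)) := fun u => Matrix.isUnit_exp _
  have hW : ∀ u ∈ D, HasDerivAt W (b (Complex.exp u) * W u) u := fun u hu => by
    obtain ⟨Y', hd, he⟩ := hY.hasDerivAt hopen hu
    have := (hd.scomp u (Complex.hasDerivAt_exp u)).mul (hasDerivAt_exp_smul_const' (b 0) u)
    refine this.congr_deriv ?_
    rw [he]
    simp only [W, Function.comp]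
    noncomm_ring
  have hone : ∀ᶠ z in 𝓝 (0 : ℂ), IsUnit (Y z) := by
    obtain ⟨Y', hd, -⟩ := hY.hasDerivAt hopen (zero_mem_cutPlane τ₀ hc)
    refine hd.continuousAt.eventually ?_
    rw [hY.initial]
    exact Units.isOpen.mem_nhds isUnit_one
  obtain ⟨δ, hδ, hball⟩ := Metric.eventually_nhds_iff_ball.1 hone
  obtain ⟨H, T, hT, hHc, hHo, hHD, hH⟩ := exists_convex_tube
    (hopen.preimage Complex.continuous_exp) (logq_re_pos hτ₀)
    (fun u hu t ht => exp_sub_mem_cutPlane hu ht) (Real.log δ) hu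
  have h := hH.self_of_nhds
  have h1 : IsUnit (W (u - T * logq τ₀)) := by
    refine (hball _ ?_).mul (hexpu _)
    rw [mem_ball_zero_iff, Complex.norm_exp, ← Real.lt_log_iff_exp_lt hδ]
    exact h.2
  have h2 : IsUnit (W u) := matrixODE_isUnit hHc (A := fun u => b (Complex.exp u))
    ((hb.continuousOn.comp Complex.continuous_exp.continuousOn fun u hu => hu).mono hHD)
    (fun u hu => hW u (hHD hu)) (h.1 T ⟨hT, le_rfl⟩) h1 (by simpa using h.1 0 ⟨le_rfl, hT⟩)
  exact ((hexpu u).unit.isUnit_mul_units _).1 h2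

end MatrixSystem

/-! ### The spiral angle -/

section Angle

/-- The spiral angle of `exp u`: a continuous determination on the plane of the logarithm `u`. It
is constant on the lines that `exp` maps to the spirals. -/
def ang (τ₀ u : ℂ) : ℝ := u.im + τ₀.re / τ₀.im * u.re

theorem ang_add (τ₀ u w : ℂ) : ang τ₀ (u + w) = ang τ₀ u + ang τ₀ w := by
  simp [ang]
  ring

theorem ang_neg (τ₀ u : ℂ) : ang τ₀ (-u) = -ang τ₀ u := by
  simp [ang]
  ring

theorem ang_sub (τ₀ u w : ℂ) : ang τ₀ (u - w) = ang τ₀ u - ang τ₀ w := by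
  rw [sub_eq_add_neg, ang_add, ang_neg, sub_eq_add_neg]

theorem ang_real_mul (τ₀ u : ℂ) (t : ℝ) : ang τ₀ (t * u) = t * ang τ₀ u := by
  simp [ang]
  ring

theorem ang_real_mul_I (τ₀ : ℂ) (t : ℝ) : ang τ₀ (t * Complex.I) = t := by
  simp [ang]

theorem ang_int_mul (τ₀ : ℂ) (m : ℤ) : ang τ₀ (m * (2 * Real.pi * Complex.I)) = m * (2 * Real.pi) := by
  simp [ang]

theorem ang_two_pi_I (τ₀ : ℂ) : ang τ₀ (2 * Real.pi * Complex.I) = 2 * Real.pi := by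
  simp [ang]

theorem continuous_ang (τ₀ : ℂ) : Continuous (ang τ₀) := by
  unfold ang
  fun_prop

theorem ang_logq {τ₀ : ℂ} (hτ₀ : 0 < τ₀.im) : ang τ₀ (logq τ₀) = 0 := by
  rw [ang, logq_re, logq_im]
  field_simp
  ring

/-- For `x = c q₀ ^ w`, the sign of `w.im` thus tells on which side of the spiral of `c` the point
lies. -/
theorem ang_logq_mul {τ₀ : ℂ} (hτ₀ : 0 < τ₀.im) (w : ℂ) :
    ang τ₀ (logq τ₀ * w) = 2 * Real.pi * (Complex.normSq τ₀ / τ₀.im) * w.im := by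
  rw [ang, Complex.mul_im, Complex.mul_re, logq_re, logq_im, Complex.normSq_apply]
  field_simp
  ring

theorem eq_mul_logq_of_ang_eq_zero {τ₀ : ℂ} (hτ₀ : 0 < τ₀.im) {u : ℂ} (hu : ang τ₀ u = 0) :
    u = (u.re / (2 * Real.pi * τ₀.im) : ℝ) * logq τ₀ := by
  have h : u.im = -(τ₀.re / τ₀.im * u.re) := by
    unfold ang at hu
    linarith
  apply Complex.ext
  · rw [Complex.re_ofReal_mul, logq_re]
    field_simp
  · rw [Complex.im_ofReal_mul, logq_im, h]
    field_simp

theorem convex_ang_Ioo (τ₀ : ℂ) (α β : ℝ) : Convex ℝ {u | ang τ₀ u ∈ Set.Ioo α β} := by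
  intro u hu w hw a b ha hb hab
  have h : ang τ₀ (a • u + b • w) = a • ang τ₀ u + b • ang τ₀ w := by
    rw [ang_add, Complex.real_smul, Complex.real_smul, ang_real_mul, ang_real_mul]
    rfl
  rw [Set.mem_ofPred_eq, h]
  exact convex_Ioo α β hu hw ha hb hab

theorem isOpen_ang_Ioo (τ₀ : ℂ) (α β : ℝ) : IsOpen {u | ang τ₀ u ∈ Set.Ioo α β} :=
  isOpen_Ioo.preimage (continuous_ang τ₀)

/-- Equality of exponentials, when the spiral angles are in the same period. -/
theorem eq_of_exp_eq_of_ang {τ₀ u w : ℂ} (h : Complex.exp u = Complex.exp w)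
    (ha : |ang τ₀ u - ang τ₀ w| < 2 * Real.pi) : u = w := by
  obtain ⟨m, rfl⟩ := Complex.exp_eq_exp_iff_exists_int.1 h
  rw [ang_add, add_sub_cancel_left, ang_int_mul, abs_mul, abs_of_pos Real.two_pi_pos] at ha
  have h1 : |(m : ℝ)| < 1 := by
    by_contra! hm
    nlinarith [Real.two_pi_pos]
  have h2 : m = 0 := by
    rw [← Int.abs_lt_one_iff]
    exact_mod_cast h1
  simp [h2]

/-- The parameter `s` in `logNeg` slides `u` along a spiral line to the imaginary axis, at height
`ang τ₀ u`. Subtracting `π` puts this height in `(-π, π)`, where the principal logarithm inverts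
`exp`. -/
theorem logNeg_exp {τ₀ : ℂ} (hτ₀ : 0 < τ₀.im) {u : ℂ} (hu : ang τ₀ u ∈ Set.Ioo 0 (2 * Real.pi)) :
    logNeg τ₀ (Complex.exp u) = u - Real.pi * Complex.I := by
  simp only [logNeg]
  rw [Complex.norm_exp, Real.log_exp]
  set s : ℝ := -u.re / (2 * Real.pi * τ₀.im) with hs
  have h1 : -(Complex.exp u * qpow τ₀ s) =
      Complex.exp (u + s * logq τ₀ - Real.pi * Complex.I) := by
    rw [Complex.exp_sub, Complex.exp_pi_mul_I, Complex.exp_add, qpow_eq_exp, div_neg, div_one]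
  have h2 : (u + s * logq τ₀ - Real.pi * Complex.I).im = ang τ₀ u - Real.pi := by
    rw [Complex.sub_im, Complex.add_im, Complex.im_ofReal_mul, logq_im, hs, ang]
    simp
    field_simp
  rw [h1, Complex.log_exp (by rw [h2]; linarith [hu.1]) (by rw [h2]; linarith [hu.2]), logq]
  ring

end Angle

/-! ### Holomorphy of the coefficients at finite points and at infinity -/

section Coefficients

open scoped Matrix.Norms.Operator

variable {n r : ℕ}

theorem differentiableOn_valueAt (B : Matrix (Fin n) (Fin n) (RatFunc ℂ)) :
    DifferentiableOn ℂ (valueAt B) (poles B)ᶜ := by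
  intro z hz
  refine (differentiableAt_matrix.2 fun i k => ?_).differentiableWithinAt
  have hd : (B i k).denom.eval z ≠ 0 := fun h => hz ⟨i, k, h⟩
  exact (Polynomial.differentiableAt _).fun_div (Polynomial.differentiableAt _) hd

/-- Reversing numerator and denominator with respect to the degree of the denominator removes the
case distinction at `w = 0`; there the reversed denominator is `1`, because denominators are monic.
-/
theorem valueInv_apply {B : Matrix (Fin n) (Fin n) (RatFunc ℂ)} (hB : FuchsianAtZeroInfty B)
    (w : ℂ) (i k : Fin n) : valueInv B w i k =
      -(((B i k).num.reflect (B i k).denom.natDegree).eval w /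
        ((B i k).denom.reflect (B i k).denom.natDegree).eval w) := by
  by_cases hw : w = 0
  · subst hw
    simp only [valueInv, if_true, valueAtInfty, Matrix.neg_apply, Matrix.of_apply]
    rw [← Polynomial.coeff_zero_eq_eval_zero, ← Polynomial.coeff_zero_eq_eval_zero,
      Polynomial.coeff_reflect, Polynomial.coeff_reflect, Polynomial.revAt_zero,
      Polynomial.coeff_natDegree, (RatFunc.monic_denom (B i k)).leadingCoeff, div_one]
  · have hw' : w⁻¹ ≠ 0 := inv_ne_zero hw
    let : Invertible w⁻¹ := invertibleOfNonzero hw'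
    have h : ∀ p : Polynomial ℂ, p.natDegree ≤ (B i k).denom.natDegree →
        p.eval w⁻¹ = (p.reflect (B i k).denom.natDegree).eval w * w⁻¹ ^ (B i k).denom.natDegree := by
      intro p hp
      have := Polynomial.eval₂_reflect_mul_pow (RingHom.id ℂ) w⁻¹ _ p hp
      rw [invOf_eq_inv, inv_inv] at this
      exact this.symm
    simp only [valueInv, if_neg hw, valueAt, Matrix.neg_apply, Matrix.of_apply]
    change -((B i k).num.eval w⁻¹ / (B i k).denom.eval w⁻¹) = _
    rw [h _ (hB.2 i k), h _ le_rfl, mul_div_mul_right _ _ (pow_ne_zero _ hw')]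

theorem differentiableOn_valueInv {B : Matrix (Fin n) (Fin n) (RatFunc ℂ)}
    (hB : FuchsianAtZeroInfty B) :
    DifferentiableOn ℂ (valueInv B) {w | w = 0 ∨ w⁻¹ ∉ poles B} := by
  intro w hw
  refine (differentiableAt_matrix.2 fun i k => ?_).differentiableWithinAt
  rw [funext fun w => valueInv_apply hB w i k]
  refine ((Polynomial.differentiableAt _).fun_div (Polynomial.differentiableAt _) ?_).neg
  rcases eq_or_ne w 0 with rfl | hw0
  · rw [← Polynomial.coeff_zero_eq_eval_zero, Polynomial.coeff_reflect, Polynomial.revAt_zero,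
      Polynomial.coeff_natDegree, (RatFunc.monic_denom (B i k)).leadingCoeff]
    exact one_ne_zero
  · let : Invertible w⁻¹ := invertibleOfNonzero (inv_ne_zero hw0)
    have h := Polynomial.eval₂_reflect_mul_pow (RingHom.id ℂ) w⁻¹ _ (B i k).denom le_rfl
    rw [invOf_eq_inv, inv_inv] at h
    intro h0
    have h0' : Polynomial.eval₂ (RingHom.id ℂ) w
      ((B i k).denom.reflect (B i k).denom.natDegree) = 0 := h0
    rw [h0', zero_mul] at h
    exact hw.resolve_left hw0 ⟨i, k, h.symm⟩

theorem ne_of_mem_cutPlane {τ₀ : ℂ} {c : Fin r → ℂ} {w : ℂ} (hw : w ∈ cutPlane τ₀ c) (i : Fin r) :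
    w ≠ c i := by
  simpa [qpow] using hw i 0 le_rfl

theorem cutPlane_subset_compl_poles {B : Matrix (Fin n) (Fin n) (RatFunc ℂ)} {z : Fin r → ℂ}
    (hz : Set.range z = poles B) (τ₀ : ℂ) : cutPlane τ₀ z ⊆ (poles B)ᶜ := by
  intro w hw h
  obtain ⟨i, rfl⟩ := hz ▸ h
  exact ne_of_mem_cutPlane hw i rfl

theorem cutPlane_inv_subset {B : Matrix (Fin n) (Fin n) (RatFunc ℂ)} {z : Fin r → ℂ}
    (hz : Set.range z = poles B) (τ₀ : ℂ) :
    cutPlane τ₀ z⁻¹ ⊆ {w | w = 0 ∨ w⁻¹ ∉ poles B} := by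
  refine fun w hw => Or.inr fun h => ?_
  obtain ⟨i, hi⟩ := hz ▸ h
  exact ne_of_mem_cutPlane hw i (by rw [Pi.inv_apply, hi, inv_inv])

end Coefficients

/-! ### The canonical solutions as functions of the logarithm -/

section Canonical

open scoped Matrix.Norms.Operator

variable {n r : ℕ}

/-- By `logNeg_exp` the last factor is an exponential in `u`, and its derivative cancels the term
`-Y J(0)` of the Frobenius equation. -/
theorem hasDerivAt_canonicalSolution {τ₀ : ℂ} (hτ₀ : 0 < τ₀.im) {c : Fin r → ℂ}
    (hc : ∀ i, c i ≠ 0) {b Y : ℂ → Matrix (Fin n) (Fin n) ℂ} {Q : GL (Fin n) ℂ}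
    (hY : IsFrobeniusFactor (cutPlane τ₀ c) (conj Q b) Y) {u : ℂ}
    (hu : ang τ₀ u ∈ Set.Ioo 0 (2 * Real.pi)) (huc : Complex.exp u ∈ cutPlane τ₀ c) :
    HasDerivAt (fun u => canonicalSolution τ₀ b Q Y (Complex.exp u))
      (b (Complex.exp u) * canonicalSolution τ₀ b Q Y (Complex.exp u)) u := by
  obtain ⟨Y', hd, he⟩ := hY.hasDerivAt (isOpen_cutPlane hτ₀ hc) huc
  have h1 := ((hasDerivAt_exp_smul_const' (conj Q b 0) (u - Real.pi * Complex.I)).scomp u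
    ((hasDerivAt_id u).sub_const (Real.pi * Complex.I)))
  have h2 := (((hd.scomp u (Complex.hasDerivAt_exp u)).const_mul Q.val).mul h1)
  have hev : (fun u => canonicalSolution τ₀ b Q Y (Complex.exp u)) =ᶠ[𝓝 u] fun u =>
      Q.val * Y (Complex.exp u) * NormedSpace.exp ((u - Real.pi * Complex.I) • conj Q b 0) := by
    filter_upwards [(isOpen_ang_Ioo τ₀ 0 (2 * Real.pi)).mem_nhds hu] with w hw
    rw [canonicalSolution, logNeg_exp hτ₀ hw]
  refine (h2.congr_of_eventuallyEq hev).congr_deriv ?_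
  rw [show canonicalSolution τ₀ b Q Y (Complex.exp u) = _ from hev.self_of_nhds, he]
  have hQ : Q.val * conj Q b (Complex.exp u) = b (Complex.exp u) * Q.val := by
    rw [conj, mul_assoc, ← mul_assoc, Units.mul_inv, one_mul]
  simp only [Function.comp, one_smul, id]
  rw [mul_sub, ← mul_assoc Q.val, hQ]
  noncomm_ring

theorem isUnit_canonicalSolution {τ₀ : ℂ} (hτ₀ : 0 < τ₀.im) {c : Fin r → ℂ}
    (hc : ∀ i, c i ≠ 0) {b Y : ℂ → Matrix (Fin n) (Fin n) ℂ} {Q : GL (Fin n) ℂ}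
    (hb : DifferentiableOn ℂ b (cutPlane τ₀ c))
    (hY : IsFrobeniusFactor (cutPlane τ₀ c) (conj Q b) Y) {u : ℂ}
    (huc : Complex.exp u ∈ cutPlane τ₀ c) :
    IsUnit (canonicalSolution τ₀ b Q Y (Complex.exp u)) :=
  (Q.isUnit.mul (hY.isUnit hτ₀ hc (DifferentiableOn.conj hb Q) huc)).mul (Matrix.isUnit_exp _)

/-- The lift of `z ↦ 1 / z` that preserves the range `(0, 2 π)` of angles; it carries the results at
`0` over to `∞`. -/
theorem exp_two_pi_I_sub (u : ℂ) :
    Complex.exp (2 * Real.pi * Complex.I - u) = (Complex.exp u)⁻¹ := by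
  rw [Complex.exp_sub, Complex.exp_two_pi_mul_I, one_div]

/-- The canonical solution at `∞`, as a function of `log z`. -/
theorem hasDerivAt_canonicalSolution_inv {τ₀ : ℂ} (hτ₀ : 0 < τ₀.im) {c : Fin r → ℂ}
    (hc : ∀ i, c i ≠ 0) {B : Matrix (Fin n) (Fin n) (RatFunc ℂ)}
    {Y : ℂ → Matrix (Fin n) (Fin n) ℂ} {Q : GL (Fin n) ℂ}
    (hY : IsFrobeniusFactor (cutPlane τ₀ c) (conj Q (valueInv B)) Y) {u : ℂ}
    (hu : ang τ₀ u ∈ Set.Ioo 0 (2 * Real.pi)) (huc : (Complex.exp u)⁻¹ ∈ cutPlane τ₀ c) :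
    HasDerivAt (fun u => canonicalSolution τ₀ (valueInv B) Q Y (Complex.exp u)⁻¹)
      (valueAt B (Complex.exp u) * canonicalSolution τ₀ (valueInv B) Q Y (Complex.exp u)⁻¹) u := by
  have h := hasDerivAt_canonicalSolution hτ₀ hc hY (u := 2 * Real.pi * Complex.I - u)
    (by rw [ang_sub, ang_two_pi_I]; exact ⟨by linarith [hu.2], by linarith [hu.1]⟩)
    (by rwa [exp_two_pi_I_sub])
  have h2 := h.scomp u ((hasDerivAt_id u).const_sub (2 * Real.pi * Complex.I))
  have h3 : valueInv B (Complex.exp u)⁻¹ = -valueAt B (Complex.exp u) := by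
    rw [valueInv, if_neg (inv_ne_zero (Complex.exp_ne_zero u)), inv_inv]
  simp only [Function.comp_def, exp_two_pi_I_sub, h3, neg_smul, one_smul, neg_mul,
    neg_neg] at h2
  exact h2

end Canonical

/-! ### Slices as images of strips -/

section Slices

/-- Logarithms `ζ k` of the points `c k`, whose spiral angles are the numbers `ψ 0, …, ψ m` of an
increasing sequence `0 = ψ 0 < … < ψ m < ψ (m + 1) = 2 π`. -/
structure IsAngularOrder {m : ℕ} (τ₀ : ℂ) (c : Fin (m + 1) → ℂ) (ζ : Fin (m + 1) → ℂ)
    (ψ : Fin (m + 2) → ℝ) : Prop where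
  im_pos : 0 < τ₀.im
  exp_eq : ∀ k, Complex.exp (ζ k) = c k
  ang_eq : ∀ k, ang τ₀ (ζ k) = ψ k.castSucc
  strictMono : StrictMono ψ
  zero : ψ 0 = 0
  last : ψ (Fin.last (m + 1)) = 2 * Real.pi

/-- A single circle suffices: sliding its intersection points along the spirals to the `c k` changes
no angle, so the angles of the `c k` are the arguments `φ k` up to a common constant. -/
theorem MetInOrder.exists_isAngularOrder {m : ℕ} {τ₀ : ℂ} (hτ₀ : 0 < τ₀.im)
    {c : Fin (m + 1) → ℂ} (hc : MetInOrder τ₀ c) (hc0 : c 0 = 1) :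
    ∃ ζ ψ, IsAngularOrder τ₀ c ζ ψ := by
  obtain ⟨ρ, ⟨φ, hφ, hφ', hmem⟩, hρ⟩ := (hc.and self_mem_nhdsWithin).exists
  choose t ht using hmem
  let ζ' : Fin (m + 1) → ℂ := fun k => Real.log ρ + φ k * Complex.I - t k * logq τ₀
  have hζ' : ∀ k, Complex.exp (ζ' k) = c k := fun k => by
    have h := ht k
    rw [qpow_eq_exp] at h
    rw [Complex.exp_sub, Complex.exp_add, ← Complex.ofReal_exp, Real.exp_log hρ, h,
      mul_div_cancel_right₀ _ (Complex.exp_ne_zero _)]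
  have hang : ∀ k, ang τ₀ (ζ' k) = ang τ₀ (Real.log ρ) + φ k := fun k => by
    rw [ang_sub, ang_add, ang_real_mul_I, ang_real_mul, ang_logq hτ₀, mul_zero, sub_zero]
  -- The logarithm found for `c 0 = 1` is a multiple of `2 π i`; subtracting it from all the `ζ' k`
  -- normalises the first angle to `0`.
  obtain ⟨N, hN⟩ := Complex.exp_eq_one_iff.1 ((hζ' 0).trans hc0)
  have hang0 : ang τ₀ (Real.log ρ) + φ 0 = N * (2 * Real.pi) := by
    rw [← hang, hN, ang_int_mul]
  have hmono : StrictMono (Fin.snoc (fun k => φ k - φ 0) (2 * Real.pi) : Fin (m + 2) → ℝ) := by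
    rw [Fin.strictMono_iff_lt_succ]
    intro k
    rw [Fin.snoc_castSucc]
    rcases Fin.eq_castSucc_or_eq_last k with ⟨k, rfl⟩ | rfl
    · rw [← Fin.castSucc_succ, Fin.snoc_castSucc]
      exact sub_lt_sub_right (hφ k.castSucc_lt_succ) _
    · rw [Fin.succ_last, Fin.snoc_last]
      linarith
  refine ⟨fun k => ζ' k - N * (2 * Real.pi * Complex.I),
    Fin.snoc (fun k => φ k - φ 0) (2 * Real.pi), hτ₀, fun k => ?_, fun k => ?_, hmono, ?_, ?_⟩
  · rw [Complex.exp_sub, hζ', Complex.exp_int_mul_two_pi_mul_I, div_one]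
  · rw [ang_sub, ang_int_mul, hang, Fin.snoc_castSucc, ← hang0]
    ring
  · exact (Fin.snoc_castSucc (α := fun _ => ℝ) (2 * Real.pi) (fun k => φ k - φ 0) 0).trans
      (sub_self _)
  · rw [Fin.snoc_last]

theorem exists_castSucc_le_lt_succ {m : ℕ} {ψ : Fin (m + 2) → ℝ} {x : ℝ} (h0 : ψ 0 ≤ x)
    (hx : x < ψ (Fin.last _)) : ∃ k : Fin (m + 1), ψ k.castSucc ≤ x ∧ x < ψ k.succ := by
  by_contra! h
  exact hx.not_ge (Fin.induction (motive := fun k => ψ k ≤ x) h0 (fun k hk => h k hk) _)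

namespace IsAngularOrder

variable {m : ℕ} {τ₀ : ℂ} {c ζ : Fin (m + 1) → ℂ} {ψ : Fin (m + 2) → ℝ}

/-- The strip of logarithms that `exp` maps onto the `j`-th slice. -/
def strip (τ₀ : ℂ) (ψ : Fin (m + 2) → ℝ) (j : Fin (m + 1)) : Set ℂ :=
  {u | ang τ₀ u ∈ Set.Ioo (ψ j.castSucc) (ψ j.succ)}

theorem nonneg (h : IsAngularOrder τ₀ c ζ ψ) (k : Fin (m + 2)) : 0 ≤ ψ k :=
  h.zero ▸ h.strictMono.monotone (Fin.zero_le k)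

theorem le_two_pi (h : IsAngularOrder τ₀ c ζ ψ) (k : Fin (m + 2)) : ψ k ≤ 2 * Real.pi :=
  h.last ▸ h.strictMono.monotone (Fin.le_last k)

theorem mem_Ioo (h : IsAngularOrder τ₀ c ζ ψ) {j : Fin (m + 1)} {u : ℂ} (hu : u ∈ strip τ₀ ψ j) :
    ang τ₀ u ∈ Set.Ioo 0 (2 * Real.pi) :=
  ⟨(h.nonneg _).trans_lt hu.1, hu.2.trans_le (h.le_two_pi _)⟩

/-- Both angles lie in the period `[0, 2 π)`, so no translate of the line through `ζ k` can
intervene. -/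
theorem eq_of_exp_eq (h : IsAngularOrder τ₀ c ζ ψ) {u : ℂ}
    (hu : ang τ₀ u ∈ Set.Ioo 0 (2 * Real.pi)) {k : Fin (m + 1)} {t : ℝ}
    (he : Complex.exp u = c k * qpow τ₀ t) : u = ζ k + t * logq τ₀ := by
  rw [← h.exp_eq, qpow_eq_exp, ← Complex.exp_add] at he
  refine eq_of_exp_eq_of_ang (τ₀ := τ₀) he ?_
  rw [ang_add, ang_real_mul, ang_logq h.im_pos, h.ang_eq, mul_zero, add_zero, abs_lt]
  have h1 := h.nonneg k.castSucc
  have h2 : ψ k.castSucc < 2 * Real.pi := h.last ▸ h.strictMono (Fin.castSucc_lt_last k)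
  exact ⟨by linarith [hu.1], by linarith [hu.2]⟩

theorem exp_notMem_spiral (h : IsAngularOrder τ₀ c ζ ψ) {j : Fin (m + 1)} {u : ℂ}
    (hu : u ∈ strip τ₀ ψ j) (k : Fin (m + 1)) : Complex.exp u ∉ spiral τ₀ (c k) := by
  rintro ⟨t, ht⟩
  have h1 := h.eq_of_exp_eq (h.mem_Ioo hu) ht
  obtain ⟨h2, h3⟩ := hu
  rw [h1, ang_add, ang_real_mul, ang_logq h.im_pos, h.ang_eq, mul_zero, add_zero] at h2 h3
  have h4 := h.strictMono.lt_iff_lt.1 h2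
  have h5 := h.strictMono.lt_iff_lt.1 h3
  rw [Fin.castSucc_lt_castSucc_iff] at h4
  rw [Fin.castSucc_lt_succ_iff] at h5
  exact h5.not_gt h4

theorem image_strip_subset (h : IsAngularOrder τ₀ c ζ ψ) (j : Fin (m + 1)) :
    Complex.exp '' strip τ₀ ψ j ⊆ slicedSphere τ₀ c := by
  rintro _ ⟨u, hu, rfl⟩
  exact ⟨Complex.exp_ne_zero u, h.exp_notMem_spiral hu⟩

theorem exists_strip (h : IsAngularOrder τ₀ c ζ ψ) {w : ℂ} (hw : w ∈ slicedSphere τ₀ c) :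
    ∃ k, w ∈ Complex.exp '' strip τ₀ ψ k := by
  let N : ℤ := ⌊ang τ₀ (Complex.log w) / (2 * Real.pi)⌋
  let u : ℂ := Complex.log w - N * (2 * Real.pi * Complex.I)
  have hu : Complex.exp u = w := by
    rw [Complex.exp_sub, Complex.exp_log hw.1, Complex.exp_int_mul_two_pi_mul_I, div_one]
  have hang : ang τ₀ u = ang τ₀ (Complex.log w) - N * (2 * Real.pi) := by
    rw [ang_sub, ang_int_mul]
  have h1 := (le_div_iff₀ Real.two_pi_pos).1 (Int.floor_le (ang τ₀ (Complex.log w) / (2 * Real.pi)))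
  have h2 := (div_lt_iff₀ Real.two_pi_pos).1
    (Int.lt_floor_add_one (ang τ₀ (Complex.log w) / (2 * Real.pi)))
  obtain ⟨k, hk, hk'⟩ := exists_castSucc_le_lt_succ (ψ := ψ) (x := ang τ₀ u)
    (by rw [h.zero, hang]; linarith) (by rw [h.last, hang]; linarith)
  refine ⟨k, u, ⟨hk.lt_of_ne fun he => hw.2 k ?_, hk'⟩, hu⟩
  have h3 := eq_mul_logq_of_ang_eq_zero h.im_pos (u := u - ζ k)
    (by rw [ang_sub, h.ang_eq, he, sub_self])
  refine ⟨(u - ζ k).re / (2 * Real.pi * τ₀.im), ?_⟩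
  rw [← hu, ← h.exp_eq, qpow_eq_exp, ← h3, ← Complex.exp_add, add_sub_cancel]

theorem eq_of_mem_image_strip (h : IsAngularOrder τ₀ c ζ ψ) {j k : Fin (m + 1)} {w : ℂ}
    (hj : w ∈ Complex.exp '' strip τ₀ ψ j) (hk : w ∈ Complex.exp '' strip τ₀ ψ k) : j = k := by
  obtain ⟨u, hu, rfl⟩ := hj
  obtain ⟨u', hu', he⟩ := hk
  have h1 := h.mem_Ioo hu
  have h2 := h.mem_Ioo hu'
  have : u' = u := eq_of_exp_eq_of_ang he
    (abs_lt.2 ⟨by linarith [h1.2, h2.1], by linarith [h1.1, h2.2]⟩)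
  subst this
  have h3 := h.strictMono.lt_iff_lt.1 (hu.1.trans hu'.2)
  have h4 := h.strictMono.lt_iff_lt.1 (hu'.1.trans hu.2)
  rw [Fin.castSucc_lt_succ_iff] at h3 h4
  exact le_antisymm h3 h4

theorem isOpen_image_strip (τ₀ : ℂ) (ψ : Fin (m + 2) → ℝ) (j : Fin (m + 1)) :
    IsOpen (Complex.exp '' strip τ₀ ψ j) :=
  Complex.isOpenMap_exp _ (isOpen_ang_Ioo τ₀ _ _)

/-- The points that follow the spiral of `c j` on a circle belong to the `j`-th strip. -/
theorem eventually_mem_strip (h : IsAngularOrder τ₀ c ζ ψ) (j : Fin (m + 1)) (t : ℝ) :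
    ∀ᶠ s : ℝ in 𝓝[>] 0, ζ j + t * logq τ₀ + s * Complex.I ∈ strip τ₀ ψ j := by
  have hlt := h.strictMono j.castSucc_lt_succ
  filter_upwards [Ioo_mem_nhdsGT (sub_pos.2 hlt)] with s hs
  rw [strip, Set.mem_ofPred_eq, ang_add, ang_add, ang_real_mul, ang_logq h.im_pos, ang_real_mul_I,
    h.ang_eq]
  exact ⟨by linarith [hs.1], by linarith [hs.2]⟩

/-- The images of the strips are open, connected and pairwise disjoint, and they cover the sliced
sphere; so they are its components. -/
theorem slice_eq (h : IsAngularOrder τ₀ c ζ ψ) (j : Fin (m + 1)) :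
    slice τ₀ c j = Complex.exp '' strip τ₀ ψ j := by
  have hexp : ∀ t s : ℝ, Complex.exp (ζ j + t * logq τ₀ + s * Complex.I) =
      c j * qpow τ₀ t * Complex.exp (s * Complex.I) := fun t s => by
    rw [Complex.exp_add, Complex.exp_add, h.exp_eq, qpow_eq_exp]
  apply Set.Subset.antisymm
  · rintro w ⟨_, ⟨t, rfl⟩, hs⟩
    obtain ⟨s, hs1, hs2⟩ := (hs.and (h.eventually_mem_strip j t)).exists
    have hwS : w ∈ slicedSphere τ₀ c := connectedComponentIn_nonempty_iff.1 ⟨_, hs1⟩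
    have hsub := isPreconnected_connectedComponentIn.subset_left_of_subset_union
      (s := connectedComponentIn (slicedSphere τ₀ c) w)
      (u := Complex.exp '' strip τ₀ ψ j) (v := ⋃ k ∈ {k | k ≠ j}, Complex.exp '' strip τ₀ ψ k)
      (isOpen_image_strip τ₀ ψ j)
      (isOpen_biUnion fun k _ => isOpen_image_strip τ₀ ψ k) ?_ ?_ ?_
    · exact hsub (mem_connectedComponentIn hwS)
    · rw [Set.disjoint_left]
      intro x hx hx'
      simp only [Set.mem_iUnion] at hx'
      obtain ⟨k, hk, hxk⟩ := hx'
      exact hk (h.eq_of_mem_image_strip hxk hx)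
    · intro x hx
      obtain ⟨k, hk⟩ := h.exists_strip (connectedComponentIn_subset _ _ hx)
      by_cases hkj : k = j
      · exact Or.inl (hkj ▸ hk)
      · exact Or.inr (Set.mem_biUnion (show k ∈ {k | k ≠ j} from hkj) hk)
    · exact ⟨_, hs1, _, hs2, hexp t s⟩
  · intro w hw
    refine ⟨c j, ⟨0, by simp [qpow]⟩, ?_⟩
    filter_upwards [h.eventually_mem_strip j 0] with s hs
    have hpre : IsPreconnected (Complex.exp '' strip τ₀ ψ j) :=
      (convex_ang_Ioo τ₀ _ _).isPreconnected.image _ Complex.continuous_exp.continuousOn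
    refine hpre.subset_connectedComponentIn hw (h.image_strip_subset j) ⟨_, hs, ?_⟩
    rw [hexp]
    simp [qpow]

theorem strip_nonempty (h : IsAngularOrder τ₀ c ζ ψ) (j : Fin (m + 1)) :
    (strip τ₀ ψ j).Nonempty :=
  let ⟨_, hs⟩ := (h.eventually_mem_strip j 0).exists
  ⟨_, hs⟩

end IsAngularOrder

end Slices

/-! ### The connection matrix and continuation around a pole -/

section Connection

open scoped Matrix.Norms.Operator

variable {n r : ℕ} {τ₀ : ℂ} {z : Fin r → ℂ} {ζ : Fin (r + 1) → ℂ} {ψ : Fin (r + 2) → ℝ}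
  {B : Matrix (Fin n) (Fin n) (RatFunc ℂ)} {X₀ Xinf : ℂ → Matrix (Fin n) (Fin n) ℂ}

namespace IsAngularOrder

theorem exp_mem_cutPlane (h : IsAngularOrder τ₀ (withOne z) ζ ψ) {u : ℂ}
    (hu : ang τ₀ u ∈ Set.Ioo 0 (2 * Real.pi))
    (hne : ∀ i : Fin r, ∀ t : ℝ, 0 ≤ t → u ≠ ζ i.succ + t * logq τ₀) :
    Complex.exp u ∈ cutPlane τ₀ z :=
  fun i t ht he => hne i t ht (h.eq_of_exp_eq hu (k := i.succ) he)

/-- Inversion turns the cuts of the `w`-plane into the incoming half-spirals of the `z i`, whence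
the sign of `t`. -/
theorem inv_exp_mem_cutPlane (h : IsAngularOrder τ₀ (withOne z) ζ ψ) {u : ℂ}
    (hu : ang τ₀ u ∈ Set.Ioo 0 (2 * Real.pi))
    (hne : ∀ i : Fin r, ∀ t : ℝ, 0 ≤ t → u ≠ ζ i.succ - t * logq τ₀) :
    (Complex.exp u)⁻¹ ∈ cutPlane τ₀ z⁻¹ := by
  intro i t ht he
  refine hne i t ht ?_
  have h1 : Complex.exp u = z i * qpow τ₀ (-t) := by
    rw [← inv_inv (Complex.exp u), he, Pi.inv_apply, mul_inv, inv_inv, qpow_eq_exp, qpow_eq_exp,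
      ← Complex.exp_neg]
    push_cast
    rw [neg_mul]
  rw [h.eq_of_exp_eq hu (k := i.succ) h1]
  push_cast
  ring

theorem ne_of_mem_strip (h : IsAngularOrder τ₀ (withOne z) ζ ψ) {j : Fin (r + 1)} {u : ℂ}
    (hu : u ∈ strip τ₀ ψ j) (k : Fin (r + 1)) (t : ℝ) : u ≠ ζ k + t * logq τ₀ := by
  rintro rfl
  refine h.exp_notMem_spiral hu k ⟨t, ?_⟩
  rw [Complex.exp_add, h.exp_eq, qpow_eq_exp]

theorem exp_mem_cutPlane_of_mem_strip (h : IsAngularOrder τ₀ (withOne z) ζ ψ) {j : Fin (r + 1)}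
    {u : ℂ} (hu : u ∈ strip τ₀ ψ j) : Complex.exp u ∈ cutPlane τ₀ z :=
  h.exp_mem_cutPlane (h.mem_Ioo hu) fun _ _ _ => h.ne_of_mem_strip hu _ _

theorem inv_exp_mem_cutPlane_of_mem_strip (h : IsAngularOrder τ₀ (withOne z) ζ ψ)
    {j : Fin (r + 1)} {u : ℂ} (hu : u ∈ strip τ₀ ψ j) :
    (Complex.exp u)⁻¹ ∈ cutPlane τ₀ z⁻¹ :=
  h.inv_exp_mem_cutPlane (h.mem_Ioo hu) fun i t _ => by
    simpa [sub_eq_add_neg] using h.ne_of_mem_strip hu i.succ (-t)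

end IsAngularOrder

/-- `X` is a fundamental solution of `z X' = B X` on the part of `S` off `q₀^ℝ`, written in terms
of the logarithm of `z`. -/
structure IsFundamentalSolution (τ₀ : ℂ) (B : Matrix (Fin n) (Fin n) (RatFunc ℂ)) (S : Set ℂ)
    (X : ℂ → Matrix (Fin n) (Fin n) ℂ) : Prop where
  hasDerivAt : ∀ u, ang τ₀ u ∈ Set.Ioo 0 (2 * Real.pi) → Complex.exp u ∈ S →
    HasDerivAt (fun u => X (Complex.exp u)) (valueAt B (Complex.exp u) * X (Complex.exp u)) u
  isUnit : ∀ u, ang τ₀ u ∈ Set.Ioo 0 (2 * Real.pi) → Complex.exp u ∈ S → IsUnit (X (Complex.exp u))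

/-- The connection matrix is constant on each slice. -/
theorem existsUnique_connection (h : IsAngularOrder τ₀ (withOne z) ζ ψ)
    (hz : Set.range z = poles B) (hX₀ : IsFundamentalSolution τ₀ B (cutPlane τ₀ z) X₀)
    (hXinf : IsFundamentalSolution τ₀ B {x | x⁻¹ ∈ cutPlane τ₀ z⁻¹} Xinf) :
    ∃! P : Fin (r + 1) → GL (Fin n) ℂ,
      ∀ j, ∀ x ∈ slice τ₀ (withOne z) j, X₀ x = Xinf x * (P j).val := by
  have hunit : ∀ j, ∀ u ∈ IsAngularOrder.strip τ₀ ψ j, IsUnit (Xinf (Complex.exp u)) :=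
    fun j u hu => hXinf.isUnit u (h.mem_Ioo hu) (h.inv_exp_mem_cutPlane_of_mem_strip hu)
  have hex : ∀ j, ∃ P : GL (Fin n) ℂ, ∀ x ∈ slice τ₀ (withOne z) j, X₀ x = Xinf x * P.val := by
    intro j
    obtain ⟨u₀, hu₀⟩ := h.strip_nonempty j
    have hU₀ := hX₀.isUnit u₀ (h.mem_Ioo hu₀) (h.exp_mem_cutPlane_of_mem_strip hu₀)
    refine ⟨(hunit j u₀ hu₀).unit⁻¹ * hU₀.unit, fun x hx => ?_⟩
    rw [h.slice_eq] at hx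
    obtain ⟨u, hu, rfl⟩ := hx
    refine matrixODE_unique (convex_ang_Ioo τ₀ (ψ j.castSucc) (ψ j.succ))
      (A := fun u => valueAt B (Complex.exp u)) (F := fun u => X₀ (Complex.exp u))
      (G := fun u => Xinf (Complex.exp u)) ?_
      (fun u hu => hX₀.hasDerivAt u (h.mem_Ioo hu) (h.exp_mem_cutPlane_of_mem_strip hu))
      (fun u hu => hXinf.hasDerivAt u (h.mem_Ioo hu) (h.inv_exp_mem_cutPlane_of_mem_strip hu))
      hu₀ ?_ hu
    · exact (differentiableOn_valueAt B).continuousOn.comp Complex.continuous_exp.continuousOn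
        fun u hu => cutPlane_subset_compl_poles hz τ₀ (h.exp_mem_cutPlane_of_mem_strip hu)
    · rw [Units.val_mul, ← mul_assoc, IsUnit.mul_val_inv, one_mul, IsUnit.unit_spec]
  choose P hP using hex
  refine ⟨P, hP, fun P' hP' => funext fun j => Units.ext ?_⟩
  obtain ⟨u, hu⟩ := h.strip_nonempty j
  have hx : Complex.exp u ∈ slice τ₀ (withOne z) j := by
    rw [h.slice_eq]
    exact ⟨u, hu, rfl⟩
  exact (hunit j u hu).mul_left_cancel ((hP' j _ hx).symm.trans (hP j _ hx))

namespace IsAngularOrder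

/-- The angle of `z j` lies strictly between its two neighbours in `ψ`, which leaves room for a disc
in the coordinate `w` that meets no other spiral, not even that of `1`. -/
theorem exists_disc (h : IsAngularOrder τ₀ (withOne z) ζ ψ) (j : Fin r) :
    ∃ δ > 0, ∀ w : ℂ, ‖w‖ < δ → ang τ₀ (ζ j.succ + logq τ₀ * w) ∈
      Set.Ioo (ψ j.castSucc.castSucc) (ψ j.succ.succ) := by
  have hcont : Continuous fun w : ℂ => ang τ₀ (ζ j.succ + logq τ₀ * w) :=
    (continuous_ang τ₀).comp (by fun_prop)
  have h0 : ang τ₀ (ζ j.succ + logq τ₀ * 0) ∈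
      Set.Ioo (ψ j.castSucc.castSucc) (ψ j.succ.succ) := by
    rw [mul_zero, add_zero, h.ang_eq]
    exact ⟨h.strictMono (Fin.castSucc_lt_castSucc_iff.2 j.castSucc_lt_succ),
      h.strictMono j.succ.castSucc_lt_succ⟩
  obtain ⟨δ, hδ, hb⟩ := Metric.eventually_nhds_iff_ball.1
    (hcont.continuousAt.eventually (isOpen_Ioo.mem_nhds h0))
  exact ⟨δ, hδ, fun w hw => hb w (mem_ball_zero_iff.2 hw)⟩

/-- The middle index is the only one whose angle lies strictly between those two neighbours. -/
theorem eq_of_eq_add (h : IsAngularOrder τ₀ (withOne z) ζ ψ) {j i : Fin r} {w : ℂ} {t : ℝ}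
    (hw : ang τ₀ (ζ j.succ + logq τ₀ * w) ∈ Set.Ioo (ψ j.castSucc.castSucc) (ψ j.succ.succ))
    (he : ζ j.succ + logq τ₀ * w = ζ i.succ + t * logq τ₀) : i = j ∧ w = t := by
  rw [he, ang_add, ang_real_mul, ang_logq h.im_pos, h.ang_eq, mul_zero, add_zero] at hw
  have h1 := h.strictMono.lt_iff_lt.1 hw.1
  have h2 := h.strictMono.lt_iff_lt.1 hw.2
  have hij : i = j := by
    rw [Fin.lt_def] at h1 h2
    simp only [Fin.val_castSucc, Fin.val_succ] at h1 h2
    exact Fin.ext (by omega)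
  subst hij
  refine ⟨rfl, ?_⟩
  have hv : logq τ₀ ≠ 0 := fun hv => by
    have := logq_re_pos h.im_pos
    simp [hv] at this
  have h3 := add_left_cancel he
  rw [mul_comm] at h3
  exact mul_right_cancel₀ hv h3

theorem normSq_div_im_pos {τ₀ : ℂ} (hτ₀ : 0 < τ₀.im) :
    0 < 2 * Real.pi * (Complex.normSq τ₀ / τ₀.im) := by
  have h1 : τ₀ ≠ 0 := fun h0 => by simp [h0] at hτ₀
  have := Complex.normSq_pos.2 h1
  positivity

theorem ang_lt_iff (h : IsAngularOrder τ₀ (withOne z) ζ ψ) (k : Fin (r + 1)) (w : ℂ) :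
    ang τ₀ (ζ k + logq τ₀ * w) < ψ k.castSucc ↔ w.im < 0 := by
  have hpos := normSq_div_im_pos h.im_pos
  rw [ang_add, h.ang_eq, ang_logq_mul h.im_pos, add_lt_iff_neg_left]
  exact ⟨fun hw => (pos_iff_neg_of_mul_neg hw).1 hpos, mul_neg_of_pos_of_neg hpos⟩

theorem lt_ang_iff (h : IsAngularOrder τ₀ (withOne z) ζ ψ) (k : Fin (r + 1)) (w : ℂ) :
    ψ k.castSucc < ang τ₀ (ζ k + logq τ₀ * w) ↔ 0 < w.im := by
  have hpos := normSq_div_im_pos h.im_pos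
  rw [ang_add, h.ang_eq, ang_logq_mul h.im_pos, lt_add_iff_pos_right,
    mul_pos_iff_of_pos_left hpos]

end IsAngularOrder

theorem exp_im_neg {m : ℂ} (h1 : -Real.pi < m.im) (h2 : m.im < 0) : (Complex.exp m).im < 0 := by
  rw [Complex.exp_im]
  exact mul_neg_of_pos_of_neg (Real.exp_pos _) (Real.sin_neg_of_neg_of_neg_pi_lt h2 h1)

theorem exp_ne_ofReal_nonpos {m : ℂ} (hm : m.im ∈ Set.Ioo (-Real.pi) Real.pi) {t : ℝ}
    (ht : 0 ≤ t) : Complex.exp m ≠ -t := by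
  intro he
  have hr := congrArg Complex.re he
  have hi := congrArg Complex.im he
  rw [Complex.exp_re, Complex.neg_re, Complex.ofReal_re] at hr
  rw [Complex.exp_im, Complex.neg_im, Complex.ofReal_im, neg_zero] at hi
  have hs : Real.sin m.im = 0 := (mul_eq_zero.1 hi).resolve_left (Real.exp_pos _).ne'
  have h0 : m.im = 0 := (Real.sin_eq_zero_iff_of_lt_of_lt hm.1 hm.2).1 hs
  rw [h0, Real.cos_zero, mul_one] at hr
  linarith [Real.exp_pos m.re]

theorem exp_ne_ofReal_nonneg {m : ℂ} (hm : m.im ∈ Set.Ioo 0 (2 * Real.pi)) {t : ℝ}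
    (ht : 0 ≤ t) : Complex.exp m ≠ t := by
  intro he
  refine exp_ne_ofReal_nonpos (m := m - Real.pi * Complex.I) (t := t) ?_ ht ?_
  · simp only [Complex.sub_im, Complex.im_ofReal_mul, Complex.I_im, mul_one]
    exact ⟨by linarith [hm.1], by linarith [hm.2]⟩
  · rw [Complex.exp_sub, Complex.exp_pi_mul_I, he, div_neg, div_one]

/-- Analytic continuation of the solution `X₀` around a singular point `z j`, in terms of the
logarithm `m` of the local coordinate `w`, where `x = z j q₀ ^ w`. -/
theorem exists_log_continuation (h : IsAngularOrder τ₀ (withOne z) ζ ψ)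
    (hz : Set.range z = poles B) (hX₀ : IsFundamentalSolution τ₀ B (cutPlane τ₀ z) X₀)
    (hXinf : IsFundamentalSolution τ₀ B {x | x⁻¹ ∈ cutPlane τ₀ z⁻¹} Xinf)
    {P : Fin (r + 1) → GL (Fin n) ℂ}
    (hP : ∀ j, ∀ x ∈ slice τ₀ (withOne z) j, X₀ x = Xinf x * (P j).val) (j : Fin r)
    {δ : ℝ} (hδ : 0 < δ) (hdisc : ∀ w : ℂ, ‖w‖ < δ → ang τ₀ (ζ j.succ + logq τ₀ * w) ∈
      Set.Ioo (ψ j.castSucc.castSucc) (ψ j.succ.succ)) :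
    ∃ Φ : ℂ → Matrix (Fin n) (Fin n) ℂ, (∀ m : ℂ, m.re < Real.log δ → DifferentiableAt ℂ Φ m) ∧
      (∀ m : ℂ, m.re < Real.log δ → m.im ∈ Set.Ioo (-Real.pi) 0 →
        Φ m = X₀ (Complex.exp (ζ j.succ + logq τ₀ * Complex.exp m))) ∧
      ∀ m : ℂ, m.re < Real.log δ → m.im ∈ Set.Ioo 0 (2 * Real.pi) →
        Φ m = X₀ (Complex.exp (ζ j.succ + logq τ₀ * Complex.exp m)) *
          ((P j.succ)⁻¹ * P j.castSucc).val := by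
  set ℓ : ℂ → ℂ := fun m => ζ j.succ + logq τ₀ * Complex.exp m with hℓ
  set H : Set ℂ := {m | m.re < Real.log δ} with hH
  have hHo : IsOpen H := isOpen_lt Complex.continuous_re continuous_const
  have hHc : Convex ℝ H := convex_halfSpace_re_lt _
  have hang : ∀ m ∈ H, ang τ₀ (ℓ m) ∈ Set.Ioo (ψ j.castSucc.castSucc) (ψ j.succ.succ) :=
    fun m hm => hdisc _ (by rw [Complex.norm_exp, ← Real.lt_log_iff_exp_lt hδ]; exact hm)
  have hang' : ∀ m ∈ H, ang τ₀ (ℓ m) ∈ Set.Ioo 0 (2 * Real.pi) := fun m hm =>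
    ⟨(h.nonneg _).trans_lt (hang m hm).1, (hang m hm).2.trans_le (h.le_two_pi _)⟩
  have hℓd : ∀ m, HasDerivAt ℓ (logq τ₀ * Complex.exp m) m := fun m =>
    ((Complex.hasDerivAt_exp m).const_mul _).const_add _
  have hℓdiff : Differentiable ℂ ℓ := fun m => (hℓd m).differentiableAt
  have hpole : ∀ m ∈ H, Complex.exp (ℓ m) ∉ poles B := by
    intro m hm hmem
    obtain ⟨i, hi⟩ := hz ▸ hmem
    have h1 := h.eq_of_exp_eq (hang' m hm) (k := i.succ) (t := 0)
      (by simpa [withOne, qpow] using hi.symm)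
    have h2 := (h.eq_of_eq_add (hang m hm) h1).2
    exact Complex.exp_ne_zero m (by simp at h2)
  let A : ℂ → Matrix (Fin n) (Fin n) ℂ := fun m =>
    (logq τ₀ * Complex.exp m) • valueAt B (Complex.exp (ℓ m))
  have hA : DifferentiableOn ℂ A H := by
    have hc : DifferentiableOn ℂ (fun m => logq τ₀ * Complex.exp m) H := by fun_prop
    exact hc.smul ((differentiableOn_valueAt B).comp
      (Complex.differentiable_exp.comp hℓdiff).differentiableOn hpole)
  have hA' : DifferentiableOn ℂ
      (fun m => ContinuousLinearMap.mul ℂ (Matrix (Fin n) (Fin n) ℂ) (A m)) H :=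
    (ContinuousLinearMap.mul ℂ (Matrix (Fin n) (Fin n) ℂ)).differentiable.comp_differentiableOn hA
  have hsol : ∀ {S X}, IsFundamentalSolution τ₀ B S X → ∀ m ∈ H, Complex.exp (ℓ m) ∈ S →
      HasDerivAt (fun m => X (Complex.exp (ℓ m))) (A m * X (Complex.exp (ℓ m))) m := by
    intro S X hX m hm hS
    have := (hX.hasDerivAt (ℓ m) (hang' m hm) hS).scomp m (hℓd m)
    rw [← smul_mul_assoc] at this
    exact this
  -- In the disc, the cut of `X₀` is the half-axis `w ≥ 0`, and that of `Xinf` is `w ≤ 0`.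
  have hcut₀ : ∀ m ∈ H, (∀ t : ℝ, 0 ≤ t → Complex.exp m ≠ t) →
      Complex.exp (ℓ m) ∈ cutPlane τ₀ z := fun m hm hne =>
    h.exp_mem_cutPlane (hang' m hm) fun i t ht he =>
      hne t ht (h.eq_of_eq_add (hang m hm) he).2
  have hcutinf : ∀ m ∈ H, (∀ t : ℝ, 0 ≤ t → Complex.exp m ≠ -t) →
      Complex.exp (ℓ m) ∈ {x | x⁻¹ ∈ cutPlane τ₀ z⁻¹} := fun m hm hne =>
    h.inv_exp_mem_cutPlane (hang' m hm) fun i t ht he => by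
      have := (h.eq_of_eq_add (t := -t) (hang m hm) (by
        rw [show ζ j.succ + logq τ₀ * Complex.exp m = _ from he]; push_cast; ring)).2
      exact hne t ht (by simpa using this)
  have hconv : ∀ α β : ℝ, Convex ℝ {m : ℂ | m ∈ H ∧ m.im ∈ Set.Ioo α β} := fun α β =>
    hHc.inter ((convex_halfSpace_im_gt α).inter (convex_halfSpace_im_lt β))
  have hlow : ∀ m ∈ H, m.im ∈ Set.Ioo (-Real.pi) 0 →
      Complex.exp (ℓ m) ∈ slice τ₀ (withOne z) j.castSucc := fun m hm hi => by
    rw [h.slice_eq]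
    refine ⟨_, ⟨(hang m hm).1, ?_⟩, rfl⟩
    rw [Fin.succ_castSucc]
    exact (h.ang_lt_iff _ _).2 (exp_im_neg hi.1 hi.2)
  have hup : ∀ m ∈ H, m.im ∈ Set.Ioo 0 Real.pi →
      Complex.exp (ℓ m) ∈ slice τ₀ (withOne z) j.succ := fun m hm hi => by
    rw [h.slice_eq]
    refine ⟨_, ⟨(h.lt_ang_iff _ _).2 ?_, (hang m hm).2⟩, rfl⟩
    rw [Complex.exp_im]
    exact mul_pos (Real.exp_pos _) (Real.sin_pos_of_pos_of_lt_pi hi.1 hi.2)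
  have hπ := Real.pi_pos
  let m₀ : ℂ := ⟨Real.log δ - 1, -(Real.pi / 2)⟩
  let m₁ : ℂ := ⟨Real.log δ - 1, Real.pi / 2⟩
  have hm₀ : m₀ ∈ H := sub_one_lt (Real.log δ)
  have hm₁ : m₁ ∈ H := sub_one_lt (Real.log δ)
  have hm₀i : m₀.im ∈ Set.Ioo (-Real.pi) 0 := ⟨by dsimp only [m₀]; linarith, by dsimp only [m₀]; linarith⟩
  have hm₁i : m₁.im ∈ Set.Ioo 0 Real.pi := ⟨by dsimp only [m₁]; linarith, by dsimp only [m₁]; linarith⟩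
  -- In the variable `m = log w` the singular point has moved to `-∞` and the domain is a convex
  -- half-plane, so one solution exists on all of it; it starts as `X₀` below the positive axis of
  -- `w`.
  obtain ⟨Φ, hΦ₀, hΦ⟩ := linearODE_exists hHc hHo
    (A := fun m => ContinuousLinearMap.mul ℂ _ (A m)) hA' hm₀
    (X₀ (Complex.exp (ℓ m₀)))
  have hΦ' : ∀ m ∈ H, HasDerivAt Φ (A m * Φ m) m := hΦ
  have e1 : ∀ m ∈ H, m.im ∈ Set.Ioo (-Real.pi) 0 → Φ m = X₀ (Complex.exp (ℓ m)) := by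
    intro m hm hi
    have := matrixODE_unique (hconv (-Real.pi) 0) (hA.continuousOn.mono fun _ hx => hx.1)
      (fun u hu => hΦ' u hu.1) (G := fun m => X₀ (Complex.exp (ℓ m)))
      (fun u hu => hsol hX₀ u hu.1 (hcut₀ u hu.1 fun t ht he => ?_))
      ⟨hm₀, hm₀i⟩ (P := 1) (by rw [mul_one, hΦ₀]) ⟨hm, hi⟩
    · rwa [mul_one] at this
    · have h1 := exp_im_neg hu.2.1 hu.2.2
      rw [he, Complex.ofReal_im] at h1
      exact h1.false
  -- The positive axis of `w` is crossed at `m.im = 0`, where `Xinf` is regular.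
  have e2 : ∀ m ∈ H, m.im ∈ Set.Ioo (-Real.pi) Real.pi →
      Φ m = Xinf (Complex.exp (ℓ m)) * (P j.castSucc).val := by
    intro m hm hi
    exact matrixODE_unique (hconv (-Real.pi) Real.pi) (hA.continuousOn.mono fun _ hx => hx.1)
      (fun u hu => hΦ' u hu.1) (G := fun m => Xinf (Complex.exp (ℓ m)))
      (fun u hu => hsol hXinf u hu.1 (hcutinf u hu.1 fun t ht => exp_ne_ofReal_nonpos hu.2 ht))
      (u₀ := m₀) ⟨hm₀, hm₀i.1, hm₀i.2.trans hπ⟩ (by rw [hΦ₀, hP _ _ (hlow m₀ hm₀ hm₀i)]) ⟨hm, hi⟩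
  refine ⟨Φ, fun m hm => (hΦ' m hm).differentiableAt, e1, fun m hm hi => ?_⟩
  -- The negative axis is crossed at `m.im = π`, where `X₀` is regular; the constant factor is read
  -- off at `m₁`, in the slice `j.succ`, from both connection relations.
  refine matrixODE_unique (hconv 0 (2 * Real.pi)) (hA.continuousOn.mono fun _ hx => hx.1)
      (fun u hu => hΦ' u hu.1) (G := fun m => X₀ (Complex.exp (ℓ m)))
      (fun u hu => hsol hX₀ u hu.1 (hcut₀ u hu.1 fun t ht => exp_ne_ofReal_nonneg hu.2 ht))
      (u₀ := m₁) ⟨hm₁, hm₁i.1, hm₁i.2.trans (by linarith)⟩ ?_ ⟨hm, hi⟩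
  rw [e2 m₁ hm₁ ⟨by linarith [hm₁i.1], hm₁i.2⟩, hP _ _ (hup m₁ hm₁ hm₁i), mul_assoc, ← Units.val_mul,
    mul_inv_cancel_left]

end Connection

/-! ### Logarithms along loops and analytic continuation -/

section Loops

variable {n r : ℕ}

theorem eq_of_exp_eq_of_im {x y : ℂ} (h : Complex.exp x = Complex.exp y)
    (ha : |x.im - y.im| < 2 * Real.pi) : x = y := by
  refine eq_of_exp_eq_of_ang (τ₀ := Complex.I) h ?_
  simpa [ang] using ha

theorem exists_int_sub_mem_Ioo {x : ℝ} (hx : Real.sin x < 0) :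
    ∃ k : ℤ, x - k * (2 * Real.pi) ∈ Set.Ioo (-Real.pi) 0 := by
  have hsin : ∀ k : ℤ, Real.sin (x - k * (2 * Real.pi)) = Real.sin x := fun k =>
    Real.sin_sub_int_mul_two_pi x k
  let k : ℤ := ⌊(x + Real.pi) / (2 * Real.pi)⌋
  have h1 := (le_div_iff₀ Real.two_pi_pos).1 (Int.floor_le ((x + Real.pi) / (2 * Real.pi)))
  have h2 := (div_lt_iff₀ Real.two_pi_pos).1
    (Int.lt_floor_add_one ((x + Real.pi) / (2 * Real.pi)))
  have hk := hsin k
  refine ⟨k, lt_of_le_of_ne (by linarith) fun he => ?_, ?_⟩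
  · rw [← he, Real.sin_neg, Real.sin_pi, neg_zero] at hk
    linarith
  · by_contra! h0
    have := Real.sin_nonneg_of_nonneg_of_le_pi h0 (by linarith)
    linarith

/-- A continuous logarithm of the local coordinate `w` around `c`, where `x = c exp (v w)`, along a
loop of winding number one. -/
theorem IsPositiveLoop.exists_log {c v : ℂ} (hc : c ≠ 0) (hv : v ≠ 0) {δ : ℝ} (hδ : 0 < δ) :
    ∀ᶠ ρ : ℝ in 𝓝[>] 0, (∀ x, ‖x - c‖ < ρ → x / c ∈ Complex.slitPlane) ∧
      ∀ (a : ℂ) (γ : Path a a), IsPositiveLoop c ρ γ → ∃ m : C(unitInterval, ℂ),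
        (∀ t, Complex.exp (m t) = Complex.log (γ t / c) / v) ∧ (∀ t, (m t).re < Real.log δ) ∧
        m 1 = m 0 + 2 * Real.pi * Complex.I := by
  have hd : HasDerivAt (fun x => Complex.log (x / c)) c⁻¹ c := by
    have := ((hasDerivAt_id c).div_const c).clog (by simp [hc])
    simpa [hc] using this
  have hslit : ∀ᶠ x in 𝓝 c, x / c ∈ Complex.slitPlane :=
    (Complex.isOpen_slitPlane.preimage (continuous_id.div_const c)).mem_nhds (by simp [hc])
  have hsmall : ∀ᶠ x in 𝓝 c, ‖Complex.log (x / c) / v‖ < δ := by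
    have hcont : ContinuousAt (fun x => ‖Complex.log (x / c) / v‖) c :=
      (hd.continuousAt.div_const v).norm
    exact hcont.eventually_lt continuousAt_const (by simpa [hc] using hδ)
  -- The quotient of `log (x / c)` by its linear part tends to `1`. So its principal logarithm is
  -- single-valued near `c`, and adding it to a logarithm of `x - c` does not change the winding.
  have hquot : ∀ᶠ x in 𝓝[≠] c, Complex.log (x / c) * c / (x - c) ∈ Complex.slitPlane := by
    have h1 := (hasDerivAt_iff_tendsto_slope.1 hd).mul_const c
    rw [inv_mul_cancel₀ hc] at h1
    refine (h1.eventually (Complex.isOpen_slitPlane.mem_nhds Complex.one_mem_slitPlane)).mono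
      fun x hx => ?_
    rwa [slope_def_field, div_self hc, Complex.log_one, sub_zero, div_mul_eq_mul_div] at hx
  obtain ⟨ε, hε, hball⟩ := Metric.eventually_nhds_iff.1
    (hslit.and (hsmall.and (eventually_nhdsWithin_iff.1 hquot)))
  filter_upwards [Ioo_mem_nhdsGT hε] with ρ hρ
  have hmem : ∀ x, ‖x - c‖ < ρ → dist x c < ε := fun x hx => by
    rw [dist_eq_norm]
    exact hx.trans hρ.2
  refine ⟨fun x hx => (hball (hmem x hx)).1, fun a γ ⟨l, hl, hlρ, hl1⟩ => ?_⟩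
  have hne : ∀ t, γ t - c ≠ 0 := fun t => by
    rw [hl t, add_sub_cancel_left]
    exact Complex.exp_ne_zero _
  have hg := fun t => hball (hmem (γ t) (hlρ t))
  have hs : ∀ t, Complex.log (γ t / c) * c / (γ t - c) ∈ Complex.slitPlane := fun t =>
    (hg t).2.2 (sub_ne_zero.1 (hne t))
  have hγ : Continuous γ := γ.continuous
  have hlog : Continuous fun t => Complex.log (γ t / c) :=
    (hγ.div_const c).clog fun t => (hg t).1
  have hcont : Continuous fun t =>
      l t + Complex.log (Complex.log (γ t / c) * c / (γ t - c)) - Complex.log (v * c) :=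
    (l.continuous.add (((hlog.mul_const c).div (hγ.sub continuous_const) hne).clog hs)).sub
      continuous_const
  have hexp : ∀ t, Complex.exp
      (l t + Complex.log (Complex.log (γ t / c) * c / (γ t - c)) - Complex.log (v * c)) =
      Complex.log (γ t / c) / v := fun t => by
    have hl' : Complex.exp (l t) = γ t - c := by rw [hl t, add_sub_cancel_left]
    rw [Complex.exp_sub, Complex.exp_add, hl', Complex.exp_log (Complex.slitPlane_ne_zero (hs t)),
      Complex.exp_log (mul_ne_zero hv hc)]
    have := hne t
    field_simp
  refine ⟨⟨_, hcont⟩, hexp, fun t => ?_, ?_⟩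
  · rw [Real.lt_log_iff_exp_lt hδ, ← Complex.norm_exp]
    simp only [ContinuousMap.coe_mk]
    rw [hexp]
    exact (hg t).2.1
  · simp only [ContinuousMap.coe_mk, hl1, γ.source, γ.target]
    ring

/-- A function `Φ` of the logarithm of a local coordinate `u` gives an analytic continuation along
any path on which this logarithm has a continuous determination with values in the domain of
`Φ`. -/
theorem continuesTo_of_log {a b : ℂ} (γ : Path a b) {H : Set ℂ} (hH : IsOpen H) {u : ℂ → ℂ}
    {Φ f g F G : ℂ → Matrix (Fin n) (Fin n) ℂ}
    (hΦ : ∀ i k, DifferentiableOn ℂ (fun m => Φ m i k) H) (m : C(unitInterval, ℂ))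
    (hm : ∀ t, m t ∈ H) (hexp : ∀ t, Complex.exp (m t) = u (γ t))
    (hu : ∀ t, AnalyticAt ℂ u (γ t))
    (hF : ∀ᶠ w in 𝓝 (m 0), Φ w = F (Complex.exp w)) (hf : ∀ᶠ x in 𝓝 a, f x = F (u x))
    (hG : ∀ᶠ w in 𝓝 (m 1), Φ w = G (Complex.exp w)) (hg : ∀ᶠ x in 𝓝 b, g x = G (u x)) :
    ContinuesTo γ f g := by
  -- The branch of `log u` near `γ t` that takes the value `m t` there.
  let L : unitInterval → ℂ → ℂ := fun t x => m t + Complex.log (u x / u (γ t))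
  have hne : ∀ t, u (γ t) ≠ 0 := fun t => hexp t ▸ Complex.exp_ne_zero _
  have hLγ : ∀ t, L t (γ t) = m t := fun t => by simp [L, hne t]
  have hLa : ∀ t, AnalyticAt ℂ (L t) (γ t) := fun t =>
    analyticAt_const.add ((((hu t).div_const).clog (by simp [hne t])))
  have hLt : ∀ t, Tendsto (L t) (𝓝 (γ t)) (𝓝 (m t)) := fun t => by
    have := (hLa t).continuousAt.tendsto
    rwa [hLγ] at this
  have hLe : ∀ t, ∀ᶠ x in 𝓝 (γ t), Complex.exp (L t x) = u x := fun t => by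
    filter_upwards [(hu t).continuousAt.eventually_ne (hne t)] with x hx
    rw [Complex.exp_add, hexp, Complex.exp_log (div_ne_zero hx (hne t)), mul_div_cancel₀ _ (hne t)]
  have hLi : ∀ t, ∀ᶠ x in 𝓝 (γ t), |(L t x).im - (m t).im| < 1 := fun t => by
    have : ContinuousAt (fun x => |(L t x).im - (m t).im|) (γ t) :=
      ((Complex.continuous_im.continuousAt.comp (hLa t).continuousAt).sub continuousAt_const).abs
    exact this.eventually_lt continuousAt_const (by simp [hLγ])
  refine ⟨fun t x => Φ (L t x), fun t i k => ?_, fun t => ?_, ?_, ?_⟩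
  · have h1 : AnalyticAt ℂ (fun w => Φ w i k) (L t (γ t)) := by
      rw [hLγ]
      exact (hΦ i k).analyticAt (hH.mem_nhds (hm t))
    exact h1.comp (hLa t)
  · have hγt : Tendsto γ (𝓝 t) (𝓝 (γ t)) := γ.continuous.tendsto t
    have hmt : ∀ᶠ s in 𝓝 t, |(m s).im - (m t).im| < 1 := by
      have : Continuous fun s => |(m s).im - (m t).im| :=
        ((Complex.continuous_im.comp m.continuous).sub continuous_const).abs
      exact this.continuousAt.eventually_lt continuousAt_const (by simp)
    filter_upwards [hmt, hγt.eventually (hLe t).eventually_nhds,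
      hγt.eventually (hLi t).eventually_nhds] with s h1 h2 h3
    filter_upwards [h2, h3, hLe s, hLi s] with x h2 h3 h4 h5
    -- Two nearby branches differ by a multiple of `2 π i`, and their imaginary parts by less than
    -- `1 + 1 + 1 < 2 π`; hence they coincide.
    have h6 := Real.pi_gt_three
    rw [abs_lt] at h1 h3 h5
    exact congrArg Φ (eq_of_exp_eq_of_im (h4.trans h2.symm)
      (abs_lt.2 ⟨by linarith, by linarith⟩))
  · have h1 := hLt 0
    have h2 := hLe 0
    rw [γ.source] at h1 h2
    filter_upwards [h1.eventually hF, h2, hf] with x h3 h4 h5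
    rw [h3, h4, h5]
  · have h1 := hLt 1
    have h2 := hLe 1
    rw [γ.target] at h1 h2
    filter_upwards [h1.eventually hG, h2, hg] with x h3 h4 h5
    rw [h3, h4, h5]

end Loops

/-! ### The monodromy matrices -/

section Monodromy

open scoped Matrix.Norms.Operator

variable {n r : ℕ} {τ₀ : ℂ} {z : Fin r → ℂ} {ζ : Fin (r + 1) → ℂ} {ψ : Fin (r + 2) → ℝ}
  {B : Matrix (Fin n) (Fin n) (RatFunc ℂ)} {X₀ Xinf : ℂ → Matrix (Fin n) (Fin n) ℂ}

/-- The monodromy matrices are quotients of the values of the connection matrix. -/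
theorem isMonodromyMatrix (h : IsAngularOrder τ₀ (withOne z) ζ ψ)
    (hz : Set.range z = poles B) (hX₀ : IsFundamentalSolution τ₀ B (cutPlane τ₀ z) X₀)
    (hXinf : IsFundamentalSolution τ₀ B {x | x⁻¹ ∈ cutPlane τ₀ z⁻¹} Xinf)
    {P : Fin (r + 1) → GL (Fin n) ℂ}
    (hP : ∀ j, ∀ x ∈ slice τ₀ (withOne z) j, X₀ x = Xinf x * (P j).val) (j : Fin r) :
    IsMonodromyMatrix X₀ (slice τ₀ (withOne z) j.castSucc) (z j)
      ((P j.succ)⁻¹ * P j.castSucc).val := by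
  obtain ⟨δ, hδ, hdisc⟩ := h.exists_disc j
  obtain ⟨Φ, hΦ, hΦ₀, hΦ₁⟩ := exists_log_continuation h hz hX₀ hXinf hP j hδ hdisc
  have hv : logq τ₀ ≠ 0 := fun hv => by
    have := logq_re_pos h.im_pos
    simp [hv] at this
  have hζ : Complex.exp (ζ j.succ) = z j := h.exp_eq j.succ
  have hc : z j ≠ 0 := hζ ▸ Complex.exp_ne_zero _
  filter_upwards [IsPositiveLoop.exists_log hc hv hδ] with ρ ⟨hslit, hloop⟩ a ha γ hγ
  obtain ⟨m', hexp', hre', hm1'⟩ := hloop a γ hγ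
  have hγρ : ∀ t, ‖γ t - z j‖ < ρ := hγ.choose_spec.2.1
  have hcoord : ∀ x, x / z j ∈ Complex.slitPlane →
      Complex.exp (ζ j.succ + logq τ₀ * (Complex.log (x / z j) / logq τ₀)) = x := fun x hx => by
    rw [mul_div_cancel₀ _ hv, Complex.exp_add, hζ, Complex.exp_log (Complex.slitPlane_ne_zero hx),
      mul_div_cancel₀ _ hc]
  have hcoordγ : ∀ t, ∀ᶠ x in 𝓝 (γ t),
      Complex.exp (ζ j.succ + logq τ₀ * (Complex.log (x / z j) / logq τ₀)) = x := fun t => by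
    have : ∀ᶠ x in 𝓝 (γ t), ‖x - z j‖ < ρ :=
      (isOpen_lt (by fun_prop) continuous_const).mem_nhds (hγρ t)
    exact this.mono fun x hx => hcoord x (hslit x hx)
  -- The base point lies in the slice that precedes the spiral of `z j`, that is, on the side `w.im
  -- < 0`.
  have him : (Complex.exp (m' 0)).im < 0 := by
    have h1 : a = Complex.exp (ζ j.succ + logq τ₀ * Complex.exp (m' 0)) := by
      rw [hexp', (hcoordγ 0).self_of_nhds, γ.source]
    rw [h.slice_eq] at ha
    obtain ⟨u, hu, rfl⟩ := ha
    have h2 := hdisc (Complex.exp (m' 0))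
      (by rw [Complex.norm_exp, ← Real.lt_log_iff_exp_lt hδ]; exact hre' 0)
    have h3 := h.nonneg j.castSucc.castSucc
    have h4 := h.le_two_pi j.succ.succ
    have h5 := h.mem_Ioo hu
    have h6 := eq_of_exp_eq_of_ang (τ₀ := τ₀) h1
      (abs_lt.2 ⟨by linarith [h5.1, h2.2], by linarith [h5.2, h2.1]⟩)
    have h7 := hu.2
    rw [h6, Fin.succ_castSucc] at h7
    exact (h.ang_lt_iff _ _).1 h7
  rw [Complex.exp_im] at him
  -- The logarithm of `w` is only given up to `2 π i`; it is shifted so that it starts where `Φ` is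
  -- `X₀`. One turn later it lies where `Φ` is `X₀` times the monodromy matrix.
  obtain ⟨k, hk⟩ := exists_int_sub_mem_Ioo (neg_of_mul_neg_right him (Real.exp_pos _).le)
  let m : C(unitInterval, ℂ) :=
    ⟨fun t => m' t - k * (2 * Real.pi * Complex.I), m'.continuous.sub continuous_const⟩
  have hmt : ∀ t, m t = m' t - k * (2 * Real.pi * Complex.I) := fun t => rfl
  have hexp : ∀ t, Complex.exp (m t) = Complex.log (γ t / z j) / logq τ₀ := fun t => by
    rw [hmt, Complex.exp_sub, Complex.exp_int_mul_two_pi_mul_I, div_one, hexp']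
  have hre : ∀ t, (m t).re < Real.log δ := fun t => by
    rw [hmt]
    simpa using hre' t
  have hm0 : (m 0).im ∈ Set.Ioo (-Real.pi) 0 := by
    rw [hmt]
    simpa using hk
  have hm1 : (m 1).im ∈ Set.Ioo 0 (2 * Real.pi) := by
    have h1 : (m 1).im = (m 0).im + 2 * Real.pi := by
      rw [hmt, hmt, hm1']
      simp
      ring
    rw [h1]
    exact ⟨by linarith [hm0.1, Real.pi_pos], by linarith [hm0.2]⟩
  have hHo : IsOpen {w : ℂ | w.re < Real.log δ} := isOpen_lt Complex.continuous_re continuous_const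
  have him_nhds : ∀ {w : ℂ} {α β : ℝ}, w.im ∈ Set.Ioo α β → ∀ᶠ x : ℂ in 𝓝 w, x.im ∈ Set.Ioo α β :=
    fun hw => Complex.continuous_im.continuousAt.eventually (isOpen_Ioo.mem_nhds hw)
  have hca := hcoordγ 0
  rw [γ.source] at hca
  refine continuesTo_of_log γ hHo (u := fun x => Complex.log (x / z j) / logq τ₀) (Φ := Φ)
    (F := fun w => X₀ (Complex.exp (ζ j.succ + logq τ₀ * w)))
    (G := fun w => X₀ (Complex.exp (ζ j.succ + logq τ₀ * w)) * ((P j.succ)⁻¹ * P j.castSucc).val)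
    (fun i k w hw => (differentiableAt_matrix.1 (hΦ w hw) i k).differentiableWithinAt) m hre hexp
    (fun t => (analyticAt_id.div_const.clog (hslit _ (hγρ t))).div_const) ?_
    (hca.mono fun x hx => by rw [hx]) ?_ (hca.mono fun x hx => by rw [hx])
  · filter_upwards [hHo.mem_nhds (hre 0), him_nhds hm0] with w h1 h2 using hΦ₀ w h1 h2
  · filter_upwards [hHo.mem_nhds (hre 1), him_nhds hm1] with w h1 h2 using hΦ₁ w h1 h2

end Monodromy

end

end QMonodromy

/-! ### The main theorem -/

open QMonodromy in
theorem mainTheorem3 {n r : ℕ} (τ₀ : ℂ) (hτ₀ : 0 < τ₀.im)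
    (B : Matrix (Fin n) (Fin n) (RatFunc ℂ)) (hB : FuchsianAtZeroInfty B)
    (hres₀ : NonResonant (valueAt B 0)) (hresinf : NonResonant (valueAtInfty B))
    (z : Fin r → ℂ) (hz : Set.range z = poles B)
    (hdist : Function.Injective fun i => spiral τ₀ (withOne z i))
    (hord : MetInOrder τ₀ (withOne z))
    (Q₀ Qinf : GL (Fin n) ℂ) :
    (∃ Y₀, IsFrobeniusFactor (cutPlane τ₀ z) (conj Q₀ (valueAt B)) Y₀) ∧
    (∃ Yinf, IsFrobeniusFactor (cutPlane τ₀ z⁻¹) (conj Qinf (valueInv B)) Yinf) ∧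
    ∀ Y₀ Yinf X₀ Xinf : ℂ → Matrix (Fin n) (Fin n) ℂ,
      IsFrobeniusFactor (cutPlane τ₀ z) (conj Q₀ (valueAt B)) Y₀ →
      IsFrobeniusFactor (cutPlane τ₀ z⁻¹) (conj Qinf (valueInv B)) Yinf →
      (X₀ = fun x => canonicalSolution τ₀ (valueAt B) Q₀ Y₀ x) →
      (Xinf = fun x => canonicalSolution τ₀ (valueInv B) Qinf Yinf x⁻¹) →
      (∃! P : Fin (r + 1) → GL (Fin n) ℂ,
        ∀ j, ∀ x ∈ slice τ₀ (withOne z) j, X₀ x = Xinf x * (P j).val) ∧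
      ∀ P : Fin (r + 1) → GL (Fin n) ℂ,
        (∀ j, ∀ x ∈ slice τ₀ (withOne z) j, X₀ x = Xinf x * (P j).val) →
        ∀ j : Fin r,
          IsMonodromyMatrix X₀ (slice τ₀ (withOne z) j.castSucc) (z j)
            ((P j.succ)⁻¹ * P j.castSucc).val := by
  obtain ⟨ζ, ψ, h⟩ := hord.exists_isAngularOrder hτ₀ rfl
  have hz0 : ∀ i, z i ≠ 0 := fun i hi => hB.1 (hz ▸ ⟨i, hi⟩)
  have hz0' : ∀ i, z⁻¹ i ≠ 0 := fun i => inv_ne_zero (hz0 i)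
  have hb := (differentiableOn_valueAt B).mono (cutPlane_subset_compl_poles hz τ₀)
  have hbinf := (differentiableOn_valueInv hB).mono (cutPlane_inv_subset hz τ₀)
  have hres' : NonResonant (valueInv B 0) := by
    rw [valueInv, if_pos rfl]
    exact hresinf.neg
  refine ⟨exists_isFrobeniusFactor hτ₀ hz0 (QMonodromy.DifferentiableOn.conj hb Q₀)
    (hres₀.conj Q₀), exists_isFrobeniusFactor hτ₀ hz0'
    (QMonodromy.DifferentiableOn.conj hbinf Qinf) (hres'.conj Qinf), ?_⟩
  rintro Y₀ Yinf _ _ hY₀ hYinf rfl rfl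
  have hX₀ : IsFundamentalSolution τ₀ B (cutPlane τ₀ z)
      fun x => canonicalSolution τ₀ (valueAt B) Q₀ Y₀ x :=
    ⟨fun u hu hS => hasDerivAt_canonicalSolution hτ₀ hz0 hY₀ hu hS,
      fun u _ hS => isUnit_canonicalSolution hτ₀ hz0 hb hY₀ hS⟩
  have hXinf : IsFundamentalSolution τ₀ B {x | x⁻¹ ∈ cutPlane τ₀ z⁻¹}
      fun x => canonicalSolution τ₀ (valueInv B) Qinf Yinf x⁻¹ := by
    refine ⟨fun u hu hS => hasDerivAt_canonicalSolution_inv hτ₀ hz0' hYinf hu hS, fun u _ hS => ?_⟩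
    -- The point `1 / x` is written as an exponential, the form in which invertibility is available.
    rw [← exp_two_pi_I_sub]
    refine isUnit_canonicalSolution hτ₀ hz0' hbinf hYinf ?_
    rw [exp_two_pi_I_sub]
    exact hS
  exact ⟨existsUnique_connection h hz hX₀ hXinf, fun P hP j =>
    isMonodromyMatrix h hz hX₀ hXinf hP j⟩
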